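/- Let $k=(k_1,\dots,k_l)$ be positive integers, $n=k_1+\dots+k_l$, and write $z\in\mathbb{C}^n$ as $z=(z_{(1)},\dots,z_{(l)})$ with $z_{(j)}\in\mathbb{C}^{k_j}$. Let $\mathbb{U}^n$ be either $\mathbb{C}^n$ with the Fubini–Study Kähler form $i\partial\bar\partial\log(1+|z|^2)$ (the affine chart $z\mapsto[1,z]$ of $\mathbb{P}^n(\mathbb{C})$) or the unit ball $\mathbb{B}^n$ with the complex hyperbolic Kähler form $-i\partial\bar\partial\log(1-|z|^2)$. Put $V_k=\prod_{j=1}^l(\mathbb{C}^{k_j}\setminus\{0\})$ and $\pi_k:V_k\to\prod_{j=1}^l\mathbb{P}^{k_j-1}(\mathbb{C})$, $\pi_k(z)=([z_{(1)}],\dots,[z_{(l)}])$. Let $T_k\subset\mathbb{T}^n$ be the subgroup of the elements $t$ whose coordinates are constant on each block, acting by $t\cdot z=(t_1z_1,\dots,t_nz_n)$. For $h=(h_1,\dots,h_l)\in\mathbb{N}^l$ let $\mathcal{R}_k(h)$ be the set of functions on $V_k\cap\mathbb{U}^n$ of the form $a(r_1,\dots,r_l)\,\xi^{\alpha}\bar\xi^{\beta}$,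 where $r_j=|z_{(j)}|$, $\xi_{(j)}=z_{(j)}/r_j$, $a$ is a complex-valued function, and $\alpha,\beta\in\mathbb{N}^n$ satisfy $\alpha\cdot\beta=0$, $|\alpha_{(j)}|=|\beta_{(j)}|$ for all $j$, and $\alpha_{j,r}=0$ for $r>h_j$, $\beta_{j,s}=0$ for $s\le h_j$. A Lagrangian frame of a Kähler manifold $N$ is a pair $(\mathcal{O},\mathfrak{F})$ of smooth foliations of $N$ such that the leaves of both are Lagrangian submanifolds, leaves of $\mathcal{O}$ and of $\mathfrak{F}$ are orthogonal wherever they meet, $\mathcal{O}$ is Riemannian (the metric induced on its normal bundle is invariant under the leaf holonomy), and the leaves of $\mathfrak{F}$ are totally geodesic submanifolds of $N$. Then for every $p\in\prod_{j=1}^l\mathbb{P}^{k_j-1}(\mathbb{C})$ the fiber $F_p=\pi_k^{-1}(p)\cap\mathbb{U}^n$ is a complex submanifold of $\mathbb{U}^n$ of complex dimension $l$, hence a Kähler manifold with the structure inherited from $\mathbb{U}^n$, and: 1. The $T_k$-orbits in $F_p$ are the leaves of a Riemannian foliation $\mathcal{O}_p$ of $F_p$ (with leaves of real dimension $l$), and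 every symbol in $\mathcal{R}_k(h)$ is constant on each of its leaves. 2. The orthogonal complement $T\mathcal{O}_p^\perp$ of $T\mathcal{O}_p$ in $TF_p$ is integrable: it is the tangent bundle of a foliation $\mathfrak{F}_p$ of $F_p$, and $\mathfrak{F}_p$ is totally geodesic. 3. The pair $(\mathcal{O}_p,\mathfrak{F}_p)$ is a Lagrangian frame of $F_p$ for the inherited Kähler structure. -/

import Mathlib

open Set Filter Topology
open scoped ContDiff LinearAlgebra.Projectivization

/-! ### Submanifolds and foliations inside a normed space -/

/-- `M` is an embedded `𝕜`-smooth submanifold of dimension `d` of the space `E`: around each of its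
points some local diffeomorphism of `E` straightens `M` to a linear subspace of dimension `d`.
For `𝕜 = ℂ` the charts are biholomorphic, so `M` is a complex submanifold. -/
def IsSubmanifold (𝕜 : Type*) [NontriviallyNormedField 𝕜] {E : Type*} [NormedAddCommGroup E]
    [NormedSpace 𝕜 E] (d : ℕ) (M : Set E) : Prop :=
  ∀ x ∈ M, ∃ (φ : OpenPartialHomeomorph E E) (S : Submodule 𝕜 E),
    x ∈ φ.source ∧ ContDiffOn 𝕜 ∞ φ φ.source ∧ ContDiffOn 𝕜 ∞ φ.symm φ.target ∧
    Module.finrank 𝕜 S = d ∧ ∀ y ∈ φ.source, (y ∈ M ↔ φ y ∈ S)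

section Real

variable {E : Type*} [NormedAddCommGroup E] [NormedSpace ℝ E]

/-- The tangent space at `x` of a submanifold `M` (or of a leaf `M` of a foliation): the set of
velocities at `x` of the smooth curves in `M`. -/
def tangentVectors (M : Set E) (x : E) : Set E :=
  {v | ∃ γ : ℝ → E, ContDiff ℝ ∞ γ ∧ γ 0 = x ∧ HasDerivAt γ v 0 ∧ ∀ᶠ t in 𝓝 (0 : ℝ), γ t ∈ M}

/-- The family of sets `𝓛` is (the set of leaves of) a smooth foliation of the submanifold `N` by
leaves of real dimension `d`: the leaves are path connected, they partition `N`, and around each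
point of `N` there is a chart that straightens `N` to a linear subspace `S` and cuts each leaf in a
union of at most countably many plaques, a plaque being a slice parallel to a fixed
`d`-dimensional subspace `D` of `S`. -/
structure IsFoliation (d : ℕ) (N : Set E) (𝓛 : Set (Set E)) : Prop where
  subset : ∀ L ∈ 𝓛, L ⊆ N
  existsUnique_leaf : ∀ x ∈ N, ∃! L, L ∈ 𝓛 ∧ x ∈ L
  isPathConnected : ∀ L ∈ 𝓛, IsPathConnected L
  chart : ∀ x ∈ N, ∃ (φ : OpenPartialHomeomorph E E) (S D : Submodule ℝ E),
    x ∈ φ.source ∧ ContDiffOn ℝ ∞ φ φ.source ∧ ContDiffOn ℝ ∞ φ.symm φ.target ∧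
    D ≤ S ∧ Module.finrank ℝ D = d ∧
    (∀ y ∈ φ.source, (y ∈ N ↔ φ y ∈ S)) ∧
    ∀ L ∈ 𝓛, ∃ C : Set E, C.Countable ∧
      ∀ y ∈ φ.source, y ∈ N → (y ∈ L ↔ ∃ c ∈ C, φ y - c ∈ D)

/-! ### Riemannian notions

A Riemannian metric on an open subset of `E` is given as `g : E → E → E → ℝ`, where `g x v w` is the
inner product at `x` of the tangent vectors `v` and `w`; submanifolds carry the induced metric. -/

/-- The orthogonal complement of the tangent space of `L` in the tangent space of `N`. -/
def normalVectors (g : E → E → E → ℝ) (N L : Set E) (x : E) : Set E :=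
  {v | v ∈ tangentVectors N x ∧ ∀ w ∈ tangentVectors L x, g x v w = 0}

/-- `Γ` is a smooth family `s ↦ Γ · s` of paths (with parameter `t ∈ [0, 1]`), each of which
runs in one leaf. Such a family realizes the holonomy along the leaf path `Γ · 0`: it slides the
transverse curve `Γ 0 ·` along the leaves to `Γ 1 ·`, so that the (infinitesimal) holonomy maps the
class of `∂ₛ Γ 0 0` modulo the tangent space of the leaf to the class of `∂ₛ Γ 1 0`. -/
def IsLeafwiseFamily (𝓛 : Set (Set E)) (Γ : ℝ → ℝ → E) : Prop :=
  ContDiff ℝ ∞ (fun q : ℝ × ℝ => Γ q.1 q.2) ∧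
    ∀ᶠ s in 𝓝 (0 : ℝ), ∃ L ∈ 𝓛, ∀ t ∈ Icc (0 : ℝ) 1, Γ t s ∈ L

/-- `v` is the component of `u` orthogonal to the tangent space of `L` at `x`. -/
def IsNormalPart (g : E → E → E → ℝ) (L : Set E) (x u v : E) : Prop :=
  u - v ∈ tangentVectors L x ∧ ∀ w ∈ tangentVectors L x, g x v w = 0

/-- The foliation `𝓛` is Riemannian for `g`: the metric induced by `g` on the normal bundle
(identified with the orthogonal complement of the leaves) is invariant under the leaf holonomy. -/
def IsRiemannianFoliation (g : E → E → E → ℝ) (𝓛 : Set (Set E)) : Prop :=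
  ∀ Γ : ℝ → ℝ → E, IsLeafwiseFamily 𝓛 Γ → ∀ L ∈ 𝓛, Γ 0 0 ∈ L → ∀ v w : E,
    IsNormalPart g L (Γ 0 0) (deriv (fun s => Γ 0 s) 0) v →
    IsNormalPart g L (Γ 1 0) (deriv (fun s => Γ 1 s) 0) w →
    g (Γ 0 0) v v = g (Γ 1 0) w w

/-- The inner product with `w` of the covariant acceleration of `γ` for the Levi-Civita connection
of `g`, that is `g(γ'', w) + (∂_{γ'} g)(γ', w) - 1/2 (∂_w g)(γ', γ')`. -/
noncomputable def covariantAcceleration (g : E → E → E → ℝ) (γ : ℝ → E) (t : ℝ) (w : E) : ℝ :=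
  g (γ t) (deriv (deriv γ) t) w
    + fderiv ℝ (fun x => g x (deriv γ t) w) (γ t) (deriv γ t)
    - (1 / 2) * fderiv ℝ (fun x => g x (deriv γ t) (deriv γ t)) (γ t) w

/-- `γ` is on the interval `(a, b)` a geodesic of the submanifold `M` with the metric induced by
`g`: a smooth curve in `M` whose covariant acceleration is orthogonal to `M` (the
Levi-Civita connection of `M` is the tangential part of that of the ambient space). -/
def IsGeodesicOn (g : E → E → E → ℝ) (M : Set E) (a b : ℝ) (γ : ℝ → E) : Prop :=
  ContDiffOn ℝ ∞ γ (Ioo a b) ∧ (∀ t ∈ Ioo a b, γ t ∈ M) ∧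
    ∀ t ∈ Ioo a b, ∀ w ∈ tangentVectors M (γ t), covariantAcceleration g γ t w = 0

/-- `L` is a totally geodesic submanifold of `N`: each geodesic of `L` is a geodesic of `N`. -/
def IsTotallyGeodesic (g : E → E → E → ℝ) (N L : Set E) : Prop :=
  ∀ (a b : ℝ) (γ : ℝ → E), IsGeodesicOn g L a b γ → IsGeodesicOn g N a b γ

end Real

/-! ### Kähler notions -/

section Complex

variable {E : Type*} [NormedAddCommGroup E] [NormedSpace ℂ E]

/-- The fundamental form `ω(v, w) = g(J v, w)`, where `J` is multiplication by `i`. -/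
def fundamentalForm (g : E → E → E → ℝ) (x v w : E) : ℝ :=
  g x (Complex.I • v) w

/-- `g` is a Kähler metric on the open set `U`: a smooth Riemannian metric that is invariant under
the complex structure and has a closed fundamental form. -/
structure IsKahlerMetric (g : E → E → E → ℝ) (U : Set E) : Prop where
  isOpen : IsOpen U
  smooth : ∀ v w : E, ContDiffOn ℝ ∞ (fun x => g x v w) U
  linear : ∀ x ∈ U, ∀ v : E, IsLinearMap ℝ (g x v)
  symm : ∀ x ∈ U, ∀ v w : E, g x v w = g x w v
  pos : ∀ x ∈ U, ∀ v : E, v ≠ 0 → 0 < g x v v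
  hermitian : ∀ x ∈ U, ∀ v w : E, g x (Complex.I • v) (Complex.I • w) = g x v w
  closed : ∀ x ∈ U, ∀ u v w : E,
    fderiv ℝ (fun y => fundamentalForm g y v w) x u
      + fderiv ℝ (fun y => fundamentalForm g y w u) x v
      + fderiv ℝ (fun y => fundamentalForm g y u v) x w = 0

/-- `N` is a complex submanifold of complex dimension `m` of the Kähler manifold `(U, g)`; so it is
itself a Kähler manifold with the inherited structure. -/
structure IsKahlerSubmanifold (g : E → E → E → ℝ) (U : Set E) (m : ℕ) (N : Set E) : Prop where
  kahler : IsKahlerMetric g U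
  subset : N ⊆ U
  submanifold : IsSubmanifold ℂ m N

/-- `L` is Lagrangian in `N`: each tangent space of `L` is its own orthogonal complement with
respect to the fundamental form, inside the tangent space of `N`. -/
def IsLagrangian (g : E → E → E → ℝ) (N L : Set E) : Prop :=
  ∀ x ∈ L, ∀ v ∈ tangentVectors N x,
    (v ∈ tangentVectors L x ↔ ∀ w ∈ tangentVectors L x, fundamentalForm g x v w = 0)

/-- `(𝓞, 𝓕)` is a Lagrangian frame of the Kähler submanifold `N` of complex dimension `m`. -/
structure IsLagrangianFrame (g : E → E → E → ℝ) (m : ℕ) (N : Set E) (𝓞 𝓕 : Set (Set E)) :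
    Prop where
  foliation_fst : IsFoliation m N 𝓞
  foliation_snd : IsFoliation m N 𝓕
  lagrangian_fst : ∀ L ∈ 𝓞, IsLagrangian g N L
  lagrangian_snd : ∀ L ∈ 𝓕, IsLagrangian g N L
  orthogonal : ∀ L₁ ∈ 𝓞, ∀ L₂ ∈ 𝓕, ∀ x ∈ L₁ ∩ L₂,
    ∀ v ∈ tangentVectors L₁ x, ∀ w ∈ tangentVectors L₂ x, g x v w = 0
  riemannian : IsRiemannianFoliation g 𝓞
  totallyGeodesic : ∀ L ∈ 𝓕, IsTotallyGeodesic g N L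

end Complex

/-! ### The model spaces, the torus, the fibers and the symbols -/

/-- The two geometries: `ℂⁿ` inside the complex projective space, and the complex unit ball. -/
inductive Geom where
  | projective
  | hyperbolic

section Model

variable {l : ℕ}

/-- `ℂⁿ` with `n = k₁ + ⋯ + k_l`, whose coordinates are indexed by the pairs `(j, i)` with `i`
in the `j`-th block, which has size `k_j`. -/
abbrev Cn (k : Fin l → ℕ) : Type := EuclideanSpace ℂ (Σ j : Fin l, Fin (k j))

variable {k : Fin l → ℕ}

/-- The domain `𝕌ⁿ`: all of `ℂⁿ`, or the unit ball. -/
def domain (k : Fin l → ℕ) : Geom → Set (Cn k)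
  | .projective => univ
  | .hyperbolic => Metric.ball 0 1

/-- The coefficients of the Kähler forms `i ∂∂̄ log (1 + |z|²)` (Fubini-Study, in the affine
chart `z ↦ [1, z]`) and `-i ∂∂̄ log (1 - |z|²)` (complex hyperbolic), as a Hermitian form in `u`
and `v`. Note that `inner ℂ v u = ∑ u_a * conj v_a`. -/
noncomputable def hermitianForm : Geom → Cn k → Cn k → Cn k → ℂ
  | .projective, z, u, v =>
      ((1 + ‖z‖ ^ 2) * inner ℂ v u - inner ℂ z u * inner ℂ v z) / (1 + ‖z‖ ^ 2) ^ 2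
  | .hyperbolic, z, u, v =>
      ((1 - ‖z‖ ^ 2) * inner ℂ v u + inner ℂ z u * inner ℂ v z) / (1 - ‖z‖ ^ 2) ^ 2

/-- The Kähler metric on `𝕌ⁿ` (the Kähler form `i ∑ h_{ab} dz_a ∧ dz̄_b` corresponds to
the Riemannian metric `2 Re h`). -/
noncomputable def kahlerMetric (X : Geom) (z u v : Cn k) : ℝ :=
  2 * (hermitianForm X z u v).re

/-- The block `z_(j)`. -/
def block (z : Cn k) (j : Fin l) : EuclideanSpace ℂ (Fin (k j)) :=
  WithLp.toLp 2 fun i => z ⟨j, i⟩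

/-- `V_k`, the product of the `ℂ^{k_j} \ {0}`. -/
def Vk (k : Fin l → ℕ) : Set (Cn k) := {z | ∀ j, block z j ≠ 0}

/-- The map `π_k` on `V_k`, `z ↦ ([z_(1)], …, [z_(l)])`. -/
noncomputable def piK (z : Vk k) (j : Fin l) : ℙ ℂ (EuclideanSpace ℂ (Fin (k j))) :=
  Projectivization.mk ℂ (block z.1 j) (z.2 j)

/-- The fiber `F_p` of the restriction of `π_k` to `V_k ∩ 𝕌ⁿ`. -/
def fiber (X : Geom) (p : ∀ j, ℙ ℂ (EuclideanSpace ℂ (Fin (k j)))) : Set (Cn k) :=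
  {z | z ∈ domain k X ∧ ∃ hz : z ∈ Vk k, piK ⟨z, hz⟩ = p}

/-- The action of the torus `𝕋ⁿ` on `ℂⁿ`. -/
noncomputable def torusAct (t : (Σ j : Fin l, Fin (k j)) → Circle) (z : Cn k) : Cn k :=
  WithLp.toLp 2 fun a => (t a : ℂ) * z a

/-- The subgroup `T_k` of `𝕋ⁿ`: the elements that are constant on each block. -/
def Tk (k : Fin l → ℕ) : Subgroup ((Σ j : Fin l, Fin (k j)) → Circle) where
  carrier := {t | ∃ s : Fin l → Circle, ∀ a, t a = s a.1}
  mul_mem' := by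
    rintro _ _ ⟨s, hs⟩ ⟨s', hs'⟩
    exact ⟨s * s', fun a => by simp [hs, hs']⟩
  one_mem' := ⟨1, fun _ => rfl⟩
  inv_mem' := by
    rintro _ ⟨s, hs⟩
    exact ⟨s⁻¹, fun a => by simp [hs]⟩

/-- The `T_k`-orbit of `z`. -/
def orbitTk (z : Cn k) : Set (Cn k) := {w | ∃ t ∈ Tk k, w = torusAct t z}

/-- The set of `T_k`-orbits in the fiber `F_p`. -/
def orbitLeaves (X : Geom) (p : ∀ j, ℙ ℂ (EuclideanSpace ℂ (Fin (k j)))) : Set (Set (Cn k)) :=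
  orbitTk '' fiber X p

/-- The space of symbols `𝓡_k(h)`: the functions on `V_k ∩ 𝕌ⁿ` of the form
`a(r₁, …, r_l) ξ^p ξ̄^q`, where `r_j = |z_(j)|` and `ξ_(j) = z_(j) / r_j`, the multi-indices `p`
and `q` are orthogonal with `|p_(j)| = |q_(j)|` for all `j`, in the `j`-th block `p` is
supported on the first `h_j` positions, and `q` is supported on the others. -/
def symbols (X : Geom) (k h : Fin l → ℕ) : Set (↥(Vk k ∩ domain k X) → ℂ) :=
  {f | ∃ (a : (Fin l → ℝ) → ℂ) (p q : (Σ j : Fin l, Fin (k j)) → ℕ),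
    (∑ b, p b * q b = 0) ∧
    (∀ j, ∑ i, p ⟨j, i⟩ = ∑ i, q ⟨j, i⟩) ∧
    (∀ j (i : Fin (k j)), h j ≤ i.1 → p ⟨j, i⟩ = 0) ∧
    (∀ j (i : Fin (k j)), i.1 < h j → q ⟨j, i⟩ = 0) ∧
    ∀ z, f z = a (fun j => ‖block z.1 j‖) *
      ((∏ b, (z.1 b / ‖block z.1 b.1‖) ^ p b) *
        ∏ b, (starRingEnd ℂ) (z.1 b / ‖block z.1 b.1‖) ^ q b)}

end Model

/-!
In the block `j` choose a unit vector `e j` on the line `p j`. The vectors `e j`, extended by zero,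
are orthonormal, and the fiber consists of the points `∑ j, w j • e j` of the space form with all
`w j ≠ 0`. The coordinates `log (w j)` straighten the fiber; in them the torus orbits are the
translates of `i ℝ^l`, and the complementary leaves are those of `ℝ^l`. Both are families of spirals
`w j ↦ exp (s j * ε) * w j` with real `s j`, where `ε = i` and `ε = 1`.

Let `P` be the real span of the vectors `w j • e j`. The tangent spaces of the two leaves at
`∑ j, w j • e j` are `i P` and `P`, and `P` contains the base point. The inner product is real on
`P`, hence so are the Hermitian form of the metric and its Christoffel symbols. Therefore `P` and
`i P` are orthogonal and Lagrangian, and the covariant acceleration of a curve in `P` is orthogonal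
to `i P`, so that the leaves with `ε = 1` are totally geodesic. A vector normal to an orbit has the
coordinates `ρ j * w j` with `ρ j` the real logarithmic derivative of `|w j|`, and its length
depends only on `ρ j` and `|w j|`. Leafwise transport along the orbits preserves both, so the
foliation by orbits is Riemannian.
-/

open scoped InnerProductSpace

/-! ### Complex space forms -/

theorem convexOn_sum {V ι : Type*} [AddCommGroup V] [Module ℝ V] [Fintype ι] {s : Set V}
    (hs : Convex ℝ s) {f : ι → V → ℝ} (hf : ∀ j, ConvexOn ℝ s (f j)) :
    ConvexOn ℝ s fun x => ∑ j, f j x := by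
  rw [← Finset.sum_fn]
  exact Finset.sum_induction _ (ConvexOn ℝ s) (fun _ _ => ConvexOn.add) (convexOn_const 0 hs)
    fun j _ => hf j

theorem convex_setOf_one_add_mul_pos {V : Type*} [AddCommGroup V] [Module ℝ V] {Φ : V → ℝ}
    (hΦ : ConvexOn ℝ univ Φ) (hnonneg : ∀ s, 0 ≤ Φ s) (σ : ℝ) :
    Convex ℝ {s | 0 < 1 + σ * Φ s} := by
  rcases le_total 0 σ with hσ | hσ
  · convert convex_univ (𝕜 := ℝ) (E := V)
    exact eq_univ_of_forall fun s => add_pos_of_pos_of_nonneg one_pos (mul_nonneg hσ (hnonneg s))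
  · have hset : {s | 0 < 1 + σ * Φ s} = {s ∈ univ | -σ • Φ s < 1} := by
      ext s
      simp only [mem_ofPred_eq, mem_univ, true_and, smul_eq_mul]
      constructor <;> intro h <;> linarith
    rw [hset]
    exact (hΦ.smul (neg_nonneg.2 hσ)).convex_lt 1

/-- The domain of the affine model of a complex space form of curvature sign `σ`: the points at
which `1 + σ |z|²` is positive. -/
def spaceFormDomain (E : Type*) [SeminormedAddCommGroup E] (σ : ℝ) : Set E :=
  {z | 0 < 1 + σ * ‖z‖ ^ 2}

section Domain

variable {E : Type*} [SeminormedAddCommGroup E]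

theorem isOpen_spaceFormDomain (σ : ℝ) : IsOpen (spaceFormDomain E σ) :=
  isOpen_lt continuous_const (by fun_prop)

theorem mem_spaceFormDomain_iff_of_norm_eq {σ : ℝ} {z w : E} (h : ‖z‖ = ‖w‖) :
    z ∈ spaceFormDomain E σ ↔ w ∈ spaceFormDomain E σ := by
  simp only [spaceFormDomain, mem_ofPred_eq, h]

end Domain

section SpaceForm

variable {E : Type*} [NormedAddCommGroup E] [InnerProductSpace ℂ E] {σ : ℝ} {z : E}

/-- The function `1 + σ |z|²`, written through the inner product so that it can be differentiated
as a complex-valued function. -/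
noncomputable def spaceFormDenom (σ : ℝ) (z : E) : ℂ := 1 + σ * ⟪z, z⟫_ℂ

/-- The Hermitian form `∂∂̄ (σ⁻¹ log (1 + σ |z|²))`, linear in `u` and antilinear in `v`. For
`σ = 1` and `σ = -1` it belongs to the Fubini-Study and to the complex hyperbolic metric. -/
noncomputable def spaceFormHermitian (σ : ℝ) (z u v : E) : ℂ :=
  ⟪v, u⟫_ℂ / spaceFormDenom σ z - σ * (⟪z, u⟫_ℂ * ⟪v, z⟫_ℂ) / spaceFormDenom σ z ^ 2

/-- The Riemannian metric whose Kähler form is `i ∂∂̄ (σ⁻¹ log (1 + σ |z|²))`. -/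
noncomputable def spaceFormMetric (σ : ℝ) (z u v : E) : ℝ :=
  2 * (spaceFormHermitian σ z u v).re

/-- The Christoffel symbol of the first kind `h(Γ(a, u), v)`: the holomorphic part in `a` of the
derivative of `h(u, v)` in the direction `a`. -/
noncomputable def spaceFormChristoffel (σ : ℝ) (z a u v : E) : ℂ :=
  -(σ * (⟪z, a⟫_ℂ * ⟪v, u⟫_ℂ + ⟪z, u⟫_ℂ * ⟪v, a⟫_ℂ)) / spaceFormDenom σ z ^ 2 +
    2 * σ ^ 2 * (⟪z, a⟫_ℂ * ⟪z, u⟫_ℂ * ⟪v, z⟫_ℂ) / spaceFormDenom σ z ^ 3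

theorem spaceFormDenom_eq_ofReal (σ : ℝ) (z : E) :
    spaceFormDenom σ z = ((1 + σ * ‖z‖ ^ 2 : ℝ) : ℂ) := by
  rw [spaceFormDenom, inner_self_eq_norm_sq_to_K]
  push_cast
  rfl

theorem spaceFormDenom_ne_zero (hz : z ∈ spaceFormDomain E σ) : spaceFormDenom σ z ≠ 0 := by
  rw [spaceFormDenom_eq_ofReal]
  exact Complex.ofReal_ne_zero.2 (ne_of_gt hz)

theorem conj_spaceFormDenom (σ : ℝ) (z : E) :
    starRingEnd ℂ (spaceFormDenom σ z) = spaceFormDenom σ z := by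
  rw [spaceFormDenom_eq_ofReal, Complex.conj_ofReal]

section Algebra

variable (σ z) (a b u v w : E) (c : ℂ)

theorem spaceFormHermitian_add_right :
    spaceFormHermitian σ z u (v + w) = spaceFormHermitian σ z u v + spaceFormHermitian σ z u w := by
  simp only [spaceFormHermitian, inner_add_left]
  ring

theorem spaceFormHermitian_smul_right :
    spaceFormHermitian σ z u (c • v) = starRingEnd ℂ c * spaceFormHermitian σ z u v := by
  simp only [spaceFormHermitian, inner_smul_left]
  ring

theorem conj_spaceFormHermitian :
    starRingEnd ℂ (spaceFormHermitian σ z u v) = spaceFormHermitian σ z v u := by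
  simp only [spaceFormHermitian, map_sub, map_div₀, map_mul, map_pow, inner_conj_symm,
    conj_spaceFormDenom, Complex.conj_ofReal]
  ring

theorem spaceFormMetric_symm : spaceFormMetric σ z u v = spaceFormMetric σ z v u := by
  rw [spaceFormMetric, ← conj_spaceFormHermitian, Complex.conj_re, spaceFormMetric]

theorem spaceFormMetric_add_right :
    spaceFormMetric σ z u (v + w) = spaceFormMetric σ z u v + spaceFormMetric σ z u w := by
  simp only [spaceFormMetric, spaceFormHermitian_add_right, Complex.add_re, mul_add]

theorem spaceFormMetric_smul_right (r : ℝ) :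
    spaceFormMetric σ z u (r • v) = r * spaceFormMetric σ z u v := by
  rw [← Complex.coe_smul, spaceFormMetric, spaceFormHermitian_smul_right, Complex.conj_ofReal,
    Complex.re_ofReal_mul, spaceFormMetric]
  ring

theorem spaceFormMetric_add_left :
    spaceFormMetric σ z (u + v) w = spaceFormMetric σ z u w + spaceFormMetric σ z v w := by
  rw [spaceFormMetric_symm, spaceFormMetric_add_right, spaceFormMetric_symm σ z w u,
    spaceFormMetric_symm σ z w v]

theorem spaceFormHermitian_smul_left :
    spaceFormHermitian σ z (c • u) v = c * spaceFormHermitian σ z u v := by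
  simp only [spaceFormHermitian, inner_smul_right]
  ring

theorem spaceFormHermitian_I_smul_right :
    spaceFormHermitian σ z u (Complex.I • v) = -(Complex.I * spaceFormHermitian σ z u v) := by
  rw [spaceFormHermitian_smul_right, Complex.conj_I, neg_mul]

theorem spaceFormMetric_smul_smul :
    spaceFormMetric σ z (c • u) (c • v) = ‖c‖ ^ 2 * spaceFormMetric σ z u v := by
  rw [spaceFormMetric, spaceFormHermitian_smul_left, spaceFormHermitian_smul_right, ← mul_assoc,
    Complex.mul_conj', ← Complex.ofReal_pow, Complex.re_ofReal_mul, spaceFormMetric]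
  ring

theorem spaceFormMetric_I_smul_left :
    spaceFormMetric σ z (Complex.I • u) v = -spaceFormMetric σ z u (Complex.I • v) := by
  simp only [spaceFormMetric, spaceFormHermitian_smul_left, spaceFormHermitian_I_smul_right,
    Complex.neg_re, mul_neg, neg_neg]

theorem spaceFormMetric_I_smul_I_smul :
    spaceFormMetric σ z (Complex.I • u) (Complex.I • v) = spaceFormMetric σ z u v := by
  rw [spaceFormMetric_smul_smul, Complex.norm_I, one_pow, one_mul]

theorem spaceFormChristoffel_add_right :
    spaceFormChristoffel σ z a u (v + w) =
      spaceFormChristoffel σ z a u v + spaceFormChristoffel σ z a u w := by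
  simp only [spaceFormChristoffel, inner_add_left]
  ring

theorem spaceFormChristoffel_symm :
    spaceFormChristoffel σ z a u v = spaceFormChristoffel σ z u a v := by
  simp only [spaceFormChristoffel]
  ring

theorem spaceFormChristoffel_I_smul_middle :
    spaceFormChristoffel σ z a (Complex.I • u) v = Complex.I * spaceFormChristoffel σ z a u v := by
  simp only [spaceFormChristoffel, inner_smul_right]
  ring

theorem spaceFormChristoffel_I_smul_right :
    spaceFormChristoffel σ z a u (Complex.I • v) =
      -(Complex.I * spaceFormChristoffel σ z a u v) := by
  simp only [spaceFormChristoffel, inner_smul_left, Complex.conj_I]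
  ring

end Algebra

theorem spaceFormMetric_self_pos (hz : z ∈ spaceFormDomain E σ) {v : E} (hv : v ≠ 0) :
    0 < spaceFormMetric σ z v v := by
  have hD : 0 < 1 + σ * ‖z‖ ^ 2 := hz
  have hself : spaceFormMetric σ z v v =
      2 * ((‖v‖ ^ 2 + σ * (‖z‖ ^ 2 * ‖v‖ ^ 2 - ‖⟪z, v⟫_ℂ‖ ^ 2)) / (1 + σ * ‖z‖ ^ 2) ^ 2) := by
    have h : ((‖v‖ ^ 2 + σ * (‖z‖ ^ 2 * ‖v‖ ^ 2 - ‖⟪z, v⟫_ℂ‖ ^ 2)) / (1 + σ * ‖z‖ ^ 2) ^ 2 : ℝ) =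
        spaceFormHermitian σ z v v := by
      rw [spaceFormHermitian, ← inner_conj_symm v z, Complex.mul_conj', spaceFormDenom_eq_ofReal,
        inner_self_eq_norm_sq_to_K]
      have := Complex.ofReal_ne_zero.2 hD.ne'
      push_cast at this ⊢
      simp only [Complex.coe_algebraMap]
      field_simp
      ring
    rw [spaceFormMetric, ← h, Complex.ofReal_re]
  have hcs : ‖⟪z, v⟫_ℂ‖ ^ 2 ≤ ‖z‖ ^ 2 * ‖v‖ ^ 2 := by
    rw [← mul_pow]
    gcongr
    exact norm_inner_le_norm z v
  have hv' : 0 < ‖v‖ ^ 2 := by positivity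
  rw [hself]
  refine mul_pos two_pos (div_pos ?_ (pow_pos hD 2))
  rcases le_total 0 σ with hσ | hσ
  · nlinarith [mul_nonneg hσ (sub_nonneg.2 hcs)]
  · nlinarith [mul_pos hD hv', mul_nonneg (neg_nonneg.2 hσ) (sq_nonneg ‖⟪z, v⟫_ℂ‖)]

theorem contDiff_spaceFormDenom (σ : ℝ) : ContDiff ℝ ∞ fun z : E => spaceFormDenom σ z :=
  contDiff_const.add (contDiff_const.mul (contDiff_id.inner ℂ contDiff_id))

theorem contDiffOn_spaceFormMetric (σ : ℝ) (u v : E) :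
    ContDiffOn ℝ ∞ (fun z => spaceFormMetric σ z u v) (spaceFormDomain E σ) := by
  have hD := (contDiff_spaceFormDenom (E := E) σ).contDiffOn (s := spaceFormDomain E σ)
  have hzu : ContDiff ℝ ∞ fun z : E => ⟪z, u⟫_ℂ := contDiff_id.inner ℂ contDiff_const
  have hvz : ContDiff ℝ ∞ fun z : E => ⟪v, z⟫_ℂ := contDiff_const.inner ℂ contDiff_id
  have hH : ContDiffOn ℝ ∞ (fun z => spaceFormHermitian σ z u v) (spaceFormDomain E σ) :=
    (contDiffOn_const.mul (hD.inv fun z hz => spaceFormDenom_ne_zero hz)).sub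
      ((contDiff_const.mul (hzu.mul hvz)).contDiffOn.mul
        ((hD.pow 2).inv fun z hz => pow_ne_zero 2 (spaceFormDenom_ne_zero hz)))
  exact contDiffOn_const.mul (Complex.reCLM.contDiff.comp_contDiffOn hH)

theorem hasDerivAt_spaceFormHermitian_add_smul (hz : z ∈ spaceFormDomain E σ) (a u v : E) :
    HasDerivAt (fun t : ℝ => spaceFormHermitian σ (z + t • a) u v)
      (spaceFormChristoffel σ z a u v + starRingEnd ℂ (spaceFormChristoffel σ z a v u)) 0 := by
  have hline : HasDerivAt (fun t : ℝ => z + t • a) a 0 := by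
    simpa using ((hasDerivAt_id (0 : ℝ)).smul_const a).const_add z
  have hzu : HasDerivAt (fun t : ℝ => ⟪z + t • a, u⟫_ℂ) ⟪a, u⟫_ℂ 0 :=
    (hline.inner ℂ (hasDerivAt_const (0 : ℝ) u)).congr_deriv (by simp)
  have hvz : HasDerivAt (fun t : ℝ => ⟪v, z + t • a⟫_ℂ) ⟪v, a⟫_ℂ 0 :=
    ((hasDerivAt_const (0 : ℝ) v).inner ℂ hline).congr_deriv (by simp)
  have hD : HasDerivAt (fun t : ℝ => spaceFormDenom σ (z + t • a))
      (σ * (⟪z, a⟫_ℂ + ⟪a, z⟫_ℂ)) 0 :=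
    (((hline.inner ℂ hline).const_mul (σ : ℂ)).const_add 1).congr_deriv (by simp)
  have hne := spaceFormDenom_ne_zero hz
  refine (((hasDerivAt_const (0 : ℝ) ⟪v, u⟫_ℂ).div hD (by simpa using hne)).sub
    (((hzu.mul hvz).const_mul (σ : ℂ)).div (hD.pow 2) (by simpa using hne))).congr_deriv ?_
  simp only [spaceFormChristoffel, map_add, map_neg, map_mul, map_div₀, map_pow, map_ofNat,
    inner_conj_symm, conj_spaceFormDenom, Complex.conj_ofReal, zero_smul, add_zero, Pi.mul_apply,
    Pi.pow_apply]
  field_simp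
  push_cast
  ring

theorem fderiv_spaceFormMetric (hz : z ∈ spaceFormDomain E σ) (a u v : E) :
    fderiv ℝ (fun x => spaceFormMetric σ x u v) z a =
      2 * (spaceFormChristoffel σ z a u v + spaceFormChristoffel σ z a v u).re := by
  have hdiff : DifferentiableAt ℝ (fun x => spaceFormMetric σ x u v) z :=
    ((contDiffOn_spaceFormMetric σ u v).contDiffAt
      ((isOpen_spaceFormDomain σ).mem_nhds hz)).differentiableAt (by simp)
  have hre := Complex.reCLM.hasFDerivAt.comp_hasDerivAt (0 : ℝ)
    (hasDerivAt_spaceFormHermitian_add_smul hz a u v)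
  rw [← hdiff.lineDeriv_eq_fderiv]
  refine (hre.const_mul 2).deriv.trans ?_
  rw [Complex.reCLM_apply, Complex.add_re, Complex.conj_re, Complex.add_re]

theorem fderiv_fundamentalForm_spaceFormMetric (hz : z ∈ spaceFormDomain E σ) (a u v : E) :
    fderiv ℝ (fun x => fundamentalForm (spaceFormMetric σ) x u v) z a =
      2 * (Complex.I * (spaceFormChristoffel σ z a u v - spaceFormChristoffel σ z a v u)).re := by
  rw [mul_sub, sub_eq_add_neg, ← spaceFormChristoffel_I_smul_middle,
    ← spaceFormChristoffel_I_smul_right]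
  exact fderiv_spaceFormMetric hz a (Complex.I • u) v

theorem isKahlerMetric_spaceFormMetric (σ : ℝ) :
    IsKahlerMetric (spaceFormMetric σ) (spaceFormDomain E σ) where
  isOpen := isOpen_spaceFormDomain σ
  smooth := contDiffOn_spaceFormMetric σ
  linear z _ v := ⟨spaceFormMetric_add_right σ z v, fun r w => spaceFormMetric_smul_right σ z v w r⟩
  symm z _ := spaceFormMetric_symm σ z
  pos _ hz _ := spaceFormMetric_self_pos hz
  hermitian z _ := spaceFormMetric_I_smul_I_smul σ z
  closed z hz u v w := by
    simp only [fderiv_fundamentalForm_spaceFormMetric hz]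
    rw [spaceFormChristoffel_symm σ z v u w, spaceFormChristoffel_symm σ z w v u,
      spaceFormChristoffel_symm σ z w u v, ← mul_add, ← mul_add, ← Complex.add_re, ← Complex.add_re]
    ring_nf
    simp

theorem covariantAcceleration_spaceFormMetric {γ : ℝ → E} {t : ℝ}
    (hγ : γ t ∈ spaceFormDomain E σ) (w : E) :
    covariantAcceleration (spaceFormMetric σ) γ t w =
      2 * (spaceFormHermitian σ (γ t) (deriv (deriv γ) t) w +
        spaceFormChristoffel σ (γ t) (deriv γ t) (deriv γ t) w).re := by
  rw [covariantAcceleration, fderiv_spaceFormMetric hγ, fderiv_spaceFormMetric hγ,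
    spaceFormChristoffel_symm σ (γ t) w, spaceFormMetric]
  simp only [Complex.add_re]
  ring

theorem covariantAcceleration_spaceFormMetric_add {γ : ℝ → E} {t : ℝ}
    (hγ : γ t ∈ spaceFormDomain E σ) (v w : E) :
    covariantAcceleration (spaceFormMetric σ) γ t (v + w) =
      covariantAcceleration (spaceFormMetric σ) γ t v +
        covariantAcceleration (spaceFormMetric σ) γ t w := by
  simp only [covariantAcceleration_spaceFormMetric hγ, spaceFormHermitian_add_right,
    spaceFormChristoffel_add_right, Complex.add_re]
  ring

end SpaceForm

/-! ### Totally real subspaces and orthonormal frames -/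

theorem deriv_mem_of_eventually_mem {𝕜 F : Type*} [NontriviallyNormedField 𝕜]
    [NormedAddCommGroup F] [NormedSpace 𝕜 F] {P : Submodule 𝕜 F} (hP : IsClosed (P : Set F))
    {γ : 𝕜 → F} {t : 𝕜} (hγ : ∀ᶠ s in 𝓝 t, γ s ∈ P) : deriv γ t ∈ P := by
  rw [← derivWithin_of_mem_nhds hγ]
  refine closure_minimal (Submodule.span_le.2 (image_subset_iff.2 fun s hs => hs)) hP
    (range_derivWithin_subset_closure_span_image γ (s := {s | γ s ∈ P}) ?_ ⟨t, rfl⟩)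
  exact subset_closure.trans (closure_mono fun s hs => ⟨hs, hs⟩)

section TotallyReal

variable {E : Type*} [NormedAddCommGroup E] [InnerProductSpace ℂ E] {P : Submodule ℝ E} {σ : ℝ}

/-- A real subspace on which the Hermitian inner product takes real values; equivalently `P` and
`i P` are orthogonal for the real inner product. -/
def IsTotallyReal (P : Submodule ℝ E) : Prop :=
  ∀ u ∈ P, ∀ v ∈ P, (⟪u, v⟫_ℂ).im = 0

namespace IsTotallyReal

variable (hP : IsTotallyReal P)

include hP

theorem conj_inner {u v : E} (hu : u ∈ P) (hv : v ∈ P) :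
    starRingEnd ℂ ⟪u, v⟫_ℂ = ⟪u, v⟫_ℂ :=
  Complex.conj_eq_iff_im.2 (hP u hu v hv)

theorem spaceFormHermitian_im {x u v : E} (hx : x ∈ P) (hu : u ∈ P) (hv : v ∈ P) :
    (spaceFormHermitian σ x u v).im = 0 := by
  refine Complex.conj_eq_iff_im.1 ?_
  simp only [spaceFormHermitian, map_sub, map_div₀, map_mul, map_pow, conj_spaceFormDenom,
    Complex.conj_ofReal, hP.conj_inner hv hu, hP.conj_inner hx hu, hP.conj_inner hv hx]

theorem spaceFormChristoffel_im {x a u v : E} (hx : x ∈ P) (ha : a ∈ P) (hu : u ∈ P)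
    (hv : v ∈ P) : (spaceFormChristoffel σ x a u v).im = 0 := by
  refine Complex.conj_eq_iff_im.1 ?_
  simp only [spaceFormChristoffel, map_add, map_neg, map_div₀, map_mul, map_pow, map_ofNat,
    conj_spaceFormDenom, Complex.conj_ofReal, hP.conj_inner hx ha, hP.conj_inner hv hu,
    hP.conj_inner hx hu, hP.conj_inner hv ha, hP.conj_inner hv hx]

theorem spaceFormMetric_I_smul_eq_zero {x u v : E} (hx : x ∈ P) (hu : u ∈ P) (hv : v ∈ P) :
    spaceFormMetric σ x u (Complex.I • v) = 0 := by
  rw [spaceFormMetric, spaceFormHermitian_I_smul_right, Complex.neg_re, Complex.I_mul_re,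
    hP.spaceFormHermitian_im hx hu hv, neg_zero, neg_zero, mul_zero]

theorem mem_iff_forall_spaceFormMetric_I_smul_eq_zero {x : E} (hxP : x ∈ P)
    (hx : x ∈ spaceFormDomain E σ) {v : E} (hv : ∃ a ∈ P, ∃ c ∈ P, a + Complex.I • c = v) :
    v ∈ P ↔ ∀ u ∈ P, spaceFormMetric σ x v (Complex.I • u) = 0 := by
  refine ⟨fun hv u hu => hP.spaceFormMetric_I_smul_eq_zero hxP hv hu, fun h => ?_⟩
  obtain ⟨a, ha, c, hc, rfl⟩ := hv
  have hcc : spaceFormMetric σ x c c = 0 := by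
    rw [← h c hc, spaceFormMetric_add_left, spaceFormMetric_I_smul_I_smul,
      hP.spaceFormMetric_I_smul_eq_zero hxP ha hc, zero_add]
  have hc0 : c = 0 := by
    by_contra hne
    exact (spaceFormMetric_self_pos hx hne).ne' hcc
  simpa [hc0] using ha

theorem covariantAcceleration_I_smul_eq_zero (hPc : IsClosed (P : Set E)) {γ : ℝ → E} {t : ℝ}
    (hγP : ∀ᶠ s in 𝓝 t, γ s ∈ P) (hγ : γ t ∈ spaceFormDomain E σ) {u : E} (hu : u ∈ P) :
    covariantAcceleration (spaceFormMetric σ) γ t (Complex.I • u) = 0 := by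
  have hγ' : ∀ᶠ s in 𝓝 t, deriv γ s ∈ P :=
    hγP.eventually_nhds.mono fun s hs => deriv_mem_of_eventually_mem hPc hs
  have hγ'' : deriv (deriv γ) t ∈ P := deriv_mem_of_eventually_mem hPc hγ'
  rw [covariantAcceleration_spaceFormMetric hγ, spaceFormHermitian_I_smul_right,
    spaceFormChristoffel_I_smul_right, Complex.add_re, Complex.neg_re, Complex.neg_re,
    Complex.I_mul_re, Complex.I_mul_re,
    hP.spaceFormHermitian_im hγP.self_of_nhds hγ'' hu,
    hP.spaceFormChristoffel_im hγP.self_of_nhds hγ'.self_of_nhds hγ'.self_of_nhds hu]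
  simp

end IsTotallyReal

end TotallyReal

section Frame

variable {E : Type*} [NormedAddCommGroup E] [InnerProductSpace ℂ E] {ι : Type*} {e : ι → E}

/-- The real span of the vectors `w j • e j`. At the point `frameSum e w` it is the tangent space
of the directions in which the coordinates `w j` are rescaled by real factors. -/
noncomputable def radialSpan (e : ι → E) (w : ι → ℂ) : Submodule ℝ E :=
  Submodule.span ℝ (range fun j => w j • e j)

open scoped Pointwise in
theorem smul_mem_radialSpan_smul_iff {w : ι → ℂ} {ε : ℂ} (hε : ε ≠ 0) {x : E} :
    ε • x ∈ radialSpan e (ε • w) ↔ x ∈ radialSpan e w := by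
  have hsmul : radialSpan e (ε • w) = ε • radialSpan e w := by
    simp only [radialSpan, Submodule.smul_span, smul_set_range, Pi.smul_apply, smul_assoc]
  rw [hsmul, ← SetLike.mem_coe, Submodule.coe_pointwise_smul, smul_mem_smul_set_iff₀ hε,
    SetLike.mem_coe]

theorem forall_mem_radialSpan_smul_iff {w : ι → ℂ} {ε : ℂ} (hε : ε ≠ 0) {p : E → Prop} :
    (∀ x ∈ radialSpan e (ε • w), p x) ↔ ∀ x ∈ radialSpan e w, p (ε • x) := by
  rw [(MulAction.surjective₀ hε).forall]
  simp only [smul_mem_radialSpan_smul_iff hε]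

theorem isTotallyReal_radialSpan (he : Orthonormal ℂ e) (w : ι → ℂ) :
    IsTotallyReal (radialSpan e w) := by
  intro u hu v hv
  induction hu, hv using Submodule.span_induction₂ with
  | mem_mem _ _ hx hy =>
    obtain ⟨i, rfl⟩ := hx
    obtain ⟨j, rfl⟩ := hy
    rw [inner_smul_left, inner_smul_right]
    rcases eq_or_ne i j with rfl | hij
    · rw [inner_self_eq_norm_sq_to_K, he.1, RCLike.ofReal_one, one_pow, mul_one,
        Complex.conj_mul', ← Complex.ofReal_pow, Complex.ofReal_im]
    · rw [he.2 hij, mul_zero, mul_zero, Complex.zero_im]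
  | zero_left => simp
  | zero_right => simp
  | add_left _ _ _ _ _ _ h₁ h₂ => rw [inner_add_left, Complex.add_im, h₁, h₂, add_zero]
  | add_right _ _ _ _ _ _ h₁ h₂ => rw [inner_add_right, Complex.add_im, h₁, h₂, add_zero]
  | smul_left r _ _ _ _ h =>
    rw [← Complex.coe_smul, inner_smul_left, Complex.conj_ofReal, Complex.im_ofReal_mul, h,
      mul_zero]
  | smul_right r _ _ _ _ h =>
    rw [← Complex.coe_smul, inner_smul_right, Complex.im_ofReal_mul, h, mul_zero]

theorem isClosed_radialSpan [Finite ι] (e : ι → E) (w : ι → ℂ) :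
    IsClosed (radialSpan e w : Set E) :=
  haveI : FiniteDimensional ℝ (radialSpan e w) :=
    FiniteDimensional.span_of_finite ℝ (finite_range _)
  Submodule.closed_of_finiteDimensional _

variable [Fintype ι]

/-- The linear map `w ↦ ∑ j, w j • e j`, which parametrizes the span of `e`. -/
noncomputable def frameSum (e : ι → E) : (ι → ℂ) →L[ℂ] E :=
  LinearMap.toContinuousLinearMap (Fintype.linearCombination ℂ e)

/-- The map `z ↦ (⟪e j, z⟫)_j`, which inverts `frameSum e` if `e` is orthonormal. -/
noncomputable def frameCoord (e : ι → E) : E →L[ℂ] (ι → ℂ) :=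
  ContinuousLinearMap.pi fun j => innerSL ℂ (e j)

theorem frameSum_apply (e : ι → E) (w : ι → ℂ) : frameSum e w = ∑ j, w j • e j := rfl

theorem leftInverse_frameCoord_frameSum (he : Orthonormal ℂ e) :
    Function.LeftInverse (frameCoord e) (frameSum e) :=
  fun w => funext fun j => he.inner_right_fintype w j

theorem frameSum_injective (he : Orthonormal ℂ e) : Function.Injective (frameSum e) :=
  (leftInverse_frameCoord_frameSum he).injective

theorem inner_frameSum (he : Orthonormal ℂ e) (v w : ι → ℂ) :
    ⟪frameSum e v, frameSum e w⟫_ℂ = ∑ j, starRingEnd ℂ (v j) * w j :=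
  he.inner_sum v w Finset.univ

theorem norm_frameSum_sq (he : Orthonormal ℂ e) (w : ι → ℂ) :
    ‖frameSum e w‖ ^ 2 = ∑ j, ‖w j‖ ^ 2 := by
  rw [← inner_self_eq_norm_sq (𝕜 := ℂ), inner_frameSum he, map_sum]
  refine Finset.sum_congr rfl fun j _ => ?_
  rw [Complex.conj_mul', ← Complex.ofReal_pow]
  exact Complex.ofReal_re _

theorem norm_frameSum_eq (he : Orthonormal ℂ e) {v w : ι → ℂ} (h : ∀ j, ‖v j‖ = ‖w j‖) :
    ‖frameSum e v‖ = ‖frameSum e w‖ := by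
  rw [← sq_eq_sq₀ (norm_nonneg _) (norm_nonneg _), norm_frameSum_sq he, norm_frameSum_sq he]
  simp only [h]

theorem finrank_range_frameSum (he : Orthonormal ℂ e) :
    Module.finrank ℂ (LinearMap.range (frameSum e).toLinearMap) = Fintype.card ι := by
  rw [LinearMap.finrank_range_of_inj (frameSum_injective he), Module.finrank_fintype_fun_eq_card]

theorem mem_radialSpan {w : ι → ℂ} {v : E} :
    v ∈ radialSpan e w ↔ ∃ ρ : ι → ℝ, (frameSum e fun j => ρ j * w j) = v := by
  simp only [radialSpan, Submodule.mem_span_range_iff_exists_fun, frameSum_apply, mul_smul,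
    Complex.coe_smul]

theorem frameSum_mem_radialSpan_iff (he : Orthonormal ℂ e) {w : ι → ℂ} (hw : ∀ j, w j ≠ 0)
    {v : ι → ℂ} : frameSum e v ∈ radialSpan e w ↔ ∀ j, (v j / w j).im = 0 := by
  simp only [mem_radialSpan, (frameSum_injective he).eq_iff, funext_iff]
  constructor
  · rintro ⟨ρ, hρ⟩ j
    rw [← hρ j, mul_div_cancel_right₀ _ (hw j), Complex.ofReal_im]
  · refine fun h => ⟨fun j => (v j / w j).re, fun j => ?_⟩
    rw [Complex.ext (Complex.ofReal_re _) ((Complex.ofReal_im _).trans (h j).symm),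
      div_mul_cancel₀ _ (hw j)]

theorem frameSum_mem_radialSpan_self (e : ι → E) (w : ι → ℂ) : frameSum e w ∈ radialSpan e w :=
  mem_radialSpan.2 ⟨1, by simp⟩

theorem radialSpan_le_range (w : ι → ℂ) :
    radialSpan e w ≤ (LinearMap.range (frameSum e).toLinearMap).restrictScalars ℝ := by
  intro v hv
  obtain ⟨ρ, rfl⟩ := mem_radialSpan.1 hv
  exact ⟨_, rfl⟩

theorem finrank_radialSpan (he : Orthonormal ℂ e) {w : ι → ℂ} (hw : ∀ j, w j ≠ 0) :
    Module.finrank ℝ (radialSpan e w) = Fintype.card ι :=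
  finrank_span_eq_card
    ((he.linearIndependent.units_smul fun j => Units.mk0 (w j) (hw j)).restrict_scalars' ℝ)

theorem exists_add_I_smul_eq_frameSum {w : ι → ℂ} (hw : ∀ j, w j ≠ 0) (v : ι → ℂ) :
    ∃ a ∈ radialSpan e w, ∃ c ∈ radialSpan e w, a + Complex.I • c = frameSum e v := by
  refine ⟨_, mem_radialSpan.2 ⟨fun j => (v j / w j).re, rfl⟩, _,
    mem_radialSpan.2 ⟨fun j => (v j / w j).im, rfl⟩, ?_⟩
  rw [← map_smul, ← map_add]
  refine congrArg _ (funext fun j => ?_)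
  rw [Pi.add_apply, Pi.smul_apply, smul_eq_mul, ← mul_assoc, ← add_mul, mul_comm Complex.I,
    Complex.re_add_im, div_mul_cancel₀ _ (hw j)]

end Frame

/-! ### Logarithmic charts -/

section Charts

variable {𝕜 E F : Type*} [NontriviallyNormedField 𝕜] [NormedAddCommGroup E] [NormedSpace 𝕜 E]
  [NormedAddCommGroup F] [NormedSpace 𝕜 F] {T : F →L[𝕜] E} {S : E →L[𝕜] F}

theorem isClosed_range_of_leftInverse (h : Function.LeftInverse S T) :
    IsClosed (range T) := by
  have hrange : range T = {y | T (S y) = y} :=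
    Subset.antisymm (range_subset_iff.2 fun w => congrArg T (h w)) fun y hy => ⟨S y, hy⟩
  rw [hrange]
  exact isClosed_eq (T.continuous.comp S.continuous) continuous_id

theorem retraction_add_apply_sub (h : Function.LeftInverse S T) (y : E) (x : F) :
    S (y + T (x - S y)) = x := by
  rw [map_add, h, add_sub_cancel]

theorem add_apply_sub_add_apply_sub (T : F →L[𝕜] E) (y : E) (a b : F) :
    y + T (a - b) + T (b - a) = y := by
  rw [add_assoc, ← map_add, sub_add_sub_cancel, sub_self, map_zero, add_zero]

/-- The extension of a local homeomorphism `ψ` of `F` to the space `E`, in which `F` is embedded by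
`T` with retraction `S`: it is `ψ` along `T` and the identity along the kernel of `S`. -/
def extendAlong (h : Function.LeftInverse S T) (ψ : OpenPartialHomeomorph F F) :
    OpenPartialHomeomorph E E where
  toFun y := y + T (ψ (S y) - S y)
  invFun y := y + T (ψ.symm (S y) - S y)
  source := S ⁻¹' ψ.source
  target := S ⁻¹' ψ.target
  map_source' y hy := by
    rw [mem_preimage, retraction_add_apply_sub h]
    exact ψ.map_source hy
  map_target' y hy := by
    rw [mem_preimage, retraction_add_apply_sub h]
    exact ψ.map_target hy
  left_inv' y hy := by
    rw [retraction_add_apply_sub h, ψ.left_inv hy, add_apply_sub_add_apply_sub]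
  right_inv' y hy := by
    rw [retraction_add_apply_sub h, ψ.right_inv hy, add_apply_sub_add_apply_sub]
  open_source := ψ.open_source.preimage S.continuous
  open_target := ψ.open_target.preimage S.continuous
  continuousOn_toFun := continuousOn_id.add (T.continuous.comp_continuousOn
    ((ψ.continuousOn.comp S.continuous.continuousOn fun _ hy => hy).sub S.continuous.continuousOn))
  continuousOn_invFun := continuousOn_id.add (T.continuous.comp_continuousOn
    ((ψ.symm.continuousOn.comp S.continuous.continuousOn fun _ hy => hy).sub
      S.continuous.continuousOn))

variable (h : Function.LeftInverse S T) (ψ : OpenPartialHomeomorph F F)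

theorem extendAlong_apply (w : F) : extendAlong h ψ (T w) = T (ψ w) := by
  change T w + T (ψ (S (T w)) - S (T w)) = T (ψ w)
  rw [h w, map_sub, add_sub_cancel]

theorem extendAlong_mem_range_iff {y : E} : extendAlong h ψ y ∈ range T ↔ y ∈ range T :=
  (LinearMap.range T.toLinearMap).add_mem_iff_left ⟨_, rfl⟩

theorem contDiffOn_extendAlong {n : WithTop ℕ∞} (hψ : ContDiffOn 𝕜 n ψ ψ.source) :
    ContDiffOn 𝕜 n (extendAlong h ψ) (extendAlong h ψ).source :=
  contDiffOn_id.add (T.contDiff.comp_contDiffOn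
    ((hψ.comp S.contDiff.contDiffOn fun _ hy => hy).sub S.contDiff.contDiffOn))

theorem contDiffOn_extendAlong_symm {n : WithTop ℕ∞} (hψ : ContDiffOn 𝕜 n ψ.symm ψ.target) :
    ContDiffOn 𝕜 n (extendAlong h ψ).symm (extendAlong h ψ).target :=
  contDiffOn_extendAlong h ψ.symm hψ

end Charts

section LogChart

variable {ι : Type*} [Fintype ι] {c : ι → ℂ}

/-- The coordinatewise logarithm centred at `c`, `w ↦ (log (w j / c j))_j`. -/
noncomputable def logChart (c : ι → ℂ) (hc : ∀ j, c j ≠ 0) :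
    OpenPartialHomeomorph (ι → ℂ) (ι → ℂ) :=
  OpenPartialHomeomorph.pi fun j =>
    (Homeomorph.mulRight₀ (c j)⁻¹ (inv_ne_zero (hc j))).toOpenPartialHomeomorph.trans
      Complex.expOpenPartialHomeomorph.symm

theorem mem_logChart_source (hc : ∀ j, c j ≠ 0) {w : ι → ℂ} :
    w ∈ (logChart c hc).source ↔ ∀ j, w j / c j ∈ Complex.slitPlane := by
  refine (mem_univ_pi (t := fun j => _)).trans (forall_congr' fun j => ?_)
  rw [div_eq_mul_inv]
  exact and_iff_right (mem_univ _)

theorem contDiffOn_logChart (hc : ∀ j, c j ≠ 0) :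
    ContDiffOn ℂ ∞ (logChart c hc) (logChart c hc).source := by
  refine contDiffOn_pi.2 fun j w hw => ContDiffAt.contDiffWithinAt ?_
  exact (Complex.contDiffAt_log ((mem_logChart_source hc).1 hw j)).comp w
    ((contDiff_apply ℂ ℂ j).div_const (c j)).contDiffAt

theorem contDiff_logChart_symm (hc : ∀ j, c j ≠ 0) : ContDiff ℂ ∞ (logChart c hc).symm :=
  contDiff_pi.2 fun j => (contDiff_apply ℂ ℂ j).cexp.mul contDiff_const

end LogChart

/-! ### Spirals -/

theorem eventually_eq_zero_of_eventually_exists_int_mul {X : Type*} {l : Filter X} {f : X → ℝ}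
    (hf : Tendsto f l (𝓝 0)) {κ : ℝ} (hmul : ∀ᶠ t in l, ∃ n : ℤ, f t = n * κ) :
    ∀ᶠ t in l, f t = 0 := by
  rcases eq_or_ne κ 0 with rfl | hκ
  · simpa using hmul
  · filter_upwards [hmul, hf.norm.eventually_lt_const (norm_zero.trans_lt (norm_pos_iff.2 hκ))]
      with t ⟨n, hn⟩ hlt
    rw [hn, norm_mul, mul_lt_iff_lt_one_left (norm_pos_iff.2 hκ), Int.norm_cast_real,
      Int.norm_eq_abs] at hlt
    have hn0 : n = 0 := Int.abs_lt_one_iff.1 (by exact_mod_cast hlt)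
    rw [hn, hn0, Int.cast_zero, zero_mul]

section Spiral

variable {ε a b c : ℂ}

/-- The orbit of `b` under the multiplications by `exp (s ε)` with real `s`: the circle through `b`
if `ε = i`, the open ray through `b` if `ε = 1`, and in general a logarithmic spiral. -/
def spiral (ε b : ℂ) : Set ℂ := range fun s : ℝ => Complex.exp (s * ε) * b

theorem mem_spiral : a ∈ spiral ε b ↔ ∃ s : ℝ, Complex.exp (s * ε) * b = a := Iff.rfl

theorem mem_spiral_self (ε b : ℂ) : b ∈ spiral ε b := ⟨0, by simp⟩

theorem spiral_eq_of_mem (h : a ∈ spiral ε b) : spiral ε a = spiral ε b := by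
  obtain ⟨s, rfl⟩ := mem_spiral.1 h
  rw [spiral, spiral,
    ← (Equiv.addRight s).surjective.range_comp fun r : ℝ => Complex.exp (r * ε) * b]
  refine congrArg range (funext fun r => ?_)
  simp only [Function.comp_apply, Equiv.coe_addRight, Complex.ofReal_add, add_mul, Complex.exp_add,
    mul_assoc]

theorem ne_zero_of_mem_spiral (hb : b ≠ 0) (h : a ∈ spiral ε b) : a ≠ 0 := by
  obtain ⟨s, rfl⟩ := h
  exact mul_ne_zero (Complex.exp_ne_zero _) hb

theorem div_mem_spiral_div (hc : c ≠ 0) : a / c ∈ spiral ε (b / c) ↔ a ∈ spiral ε b := by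
  simp only [mem_spiral]
  refine exists_congr fun s => ?_
  rw [← mul_div_assoc, div_left_inj' hc]

theorem mem_spiral_I_iff (hb : b ≠ 0) : a ∈ spiral Complex.I b ↔ ‖a‖ = ‖b‖ := by
  constructor
  · rintro ⟨s, rfl⟩
    rw [norm_mul, Complex.norm_exp_ofReal_mul_I, one_mul]
  · intro h
    have hnorm : ‖a / b‖ = 1 := by rw [norm_div, h, div_self (norm_ne_zero_iff.2 hb)]
    obtain ⟨s, hs⟩ := (Complex.norm_eq_one_iff _).1 hnorm
    exact mem_spiral.2 ⟨s, by rw [hs, div_mul_cancel₀ _ hb]⟩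

theorem mem_spiral_iff_exists_int (hε : ε ≠ 0) (ha : a ≠ 0) (hb : b ≠ 0) :
    a ∈ spiral ε b ↔
      ∃ n : ℤ, ((Complex.log a - (Complex.log b + n * (2 * Real.pi * Complex.I))) / ε).im = 0 := by
  have hexp : ∀ s : ℝ, Complex.exp (s * ε) * b = a ↔
      ∃ n : ℤ, Complex.log a = s * ε + Complex.log b + n * (2 * Real.pi * Complex.I) := fun s => by
    rw [← Complex.exp_eq_exp_iff_exists_int, Complex.exp_add, Complex.exp_log ha,
      Complex.exp_log hb, eq_comm]
  simp only [mem_spiral, hexp, ← Complex.conj_eq_iff_im, Complex.conj_eq_iff_real, div_eq_iff hε,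
    sub_eq_iff_eq_add, add_assoc]
  exact exists_comm

theorem im_div_eq_zero_of_eventually_mem_spiral (hε : ε ≠ 0) {u : ℝ → ℂ} {u' : ℂ} {t₀ : ℝ}
    (hu : HasDerivAt u u' t₀) (hu₀ : u t₀ ≠ 0) (hmem : ∀ᶠ t in 𝓝 t₀, u t ∈ spiral ε (u t₀)) :
    (u' / (ε * u t₀)).im = 0 := by
  have hlog : HasDerivAt (fun t => Complex.log (u t / u t₀) / ε) (u' / (ε * u t₀)) t₀ := by
    have hone : u t₀ / u t₀ = 1 := div_self hu₀
    refine (((hu.div_const _).clog_real ?_).div_const ε).congr_deriv ?_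
    · rw [hone]
      exact Complex.one_mem_slitPlane
    · rw [hone, div_one, div_div, mul_comm]
  have him := Complex.imCLM.hasFDerivAt.comp_hasDerivAt t₀ hlog
  set f : ℝ → ℝ := Complex.imCLM ∘ fun t => Complex.log (u t / u t₀) / ε with hf
  have hf₀ : f t₀ = 0 := by simp [hf, div_self hu₀]
  set κ : ℝ := (2 * Real.pi * Complex.I / ε).im
  have hmul : ∀ᶠ t in 𝓝 t₀, ∃ n : ℤ, f t = n * κ := hmem.mono fun t ht => by
    have ht' := (div_mem_spiral_div hu₀).2 ht
    rw [div_self hu₀, mem_spiral_iff_exists_int hε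
      (div_ne_zero (ne_zero_of_mem_spiral hu₀ ht) hu₀) one_ne_zero] at ht'
    obtain ⟨n, hn⟩ := ht'
    refine ⟨n, ?_⟩
    rwa [Complex.log_one, zero_add, sub_div, mul_div_assoc, Complex.sub_im, sub_eq_zero,
      ← Complex.ofReal_intCast, Complex.im_ofReal_mul] at hn
  have hzero : f =ᶠ[𝓝 t₀] fun _ => 0 :=
    eventually_eq_zero_of_eventually_exists_int_mul (hf₀ ▸ him.continuousAt) hmul
  exact him.unique ((hasDerivAt_const t₀ (0 : ℝ)).congr_of_eventuallyEq hzero)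

theorem re_div_eq_of_eventually_norm_eq {u v : ℝ → ℂ} {u' v' : ℂ} {t₀ : ℝ}
    (hu : HasDerivAt u u' t₀) (hv : HasDerivAt v v' t₀) (hnorm : ∀ᶠ t in 𝓝 t₀, ‖u t‖ = ‖v t‖) :
    (u' / u t₀).re = (v' / v t₀).re := by
  have hre : ∀ a b : ℂ, (a / b).re = inner ℝ b a / ‖b‖ ^ 2 := fun a b => by
    rw [Complex.inner, Complex.div_re, Complex.sq_norm]
    simp
    ring
  have hsq : ∀ᶠ t in 𝓝 t₀, ‖u t‖ ^ 2 = ‖v t‖ ^ 2 := hnorm.mono fun t ht => by rw [ht]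
  have hderiv := hu.norm_sq.unique (hv.norm_sq.congr_of_eventuallyEq hsq)
  rw [hre, hre, hsq.self_of_nhds, mul_left_cancel₀ two_ne_zero hderiv]

end Spiral

section TorusFiber

variable {E : Type*} [NormedAddCommGroup E] [InnerProductSpace ℂ E] {ι : Type*} [Fintype ι]
  {e : ι → E} {σ : ℝ} {ε : ℂ} {v w c : ι → ℂ}

/-- The vectors of nonzero coordinates with respect to `e` of the points of the space form. -/
def torusCoords (σ : ℝ) (e : ι → E) : Set (ι → ℂ) :=
  {w | (∀ j, w j ≠ 0) ∧ frameSum e w ∈ spaceFormDomain E σ}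

/-- The points of the space form that lie in the span of `e` and have nonzero coordinates with
respect to `e`. The fibers of `π_k` are of this form. -/
def torusFiber (σ : ℝ) (e : ι → E) : Set E := frameSum e '' torusCoords σ e

/-- The points of the torus fiber whose coordinates lie on the `ε`-spirals through those of `w`:
the torus orbit through `frameSum e w` if `ε = i`, its totally geodesic complement if `ε = 1`. -/
def spiralLeaf (σ : ℝ) (e : ι → E) (ε : ℂ) (w : ι → ℂ) : Set E :=
  frameSum e '' {v ∈ torusCoords σ e | ∀ j, v j ∈ spiral ε (w j)}

/-- The set of all spiral leaves of the torus fiber with the direction `ε`. -/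
def spiralLeaves (σ : ℝ) (e : ι → E) (ε : ℂ) : Set (Set E) :=
  spiralLeaf σ e ε '' torusCoords σ e

theorem isOpen_torusCoords (σ : ℝ) (e : ι → E) : IsOpen (torusCoords σ e) := by
  refine IsOpen.and ?_ ((isOpen_spaceFormDomain σ).preimage (frameSum e).continuous)
  simp only [Set.ofPred_forall]
  exact isOpen_iInter_of_finite fun j => isOpen_ne.preimage (continuous_apply j)

theorem frameSum_mem_spiralLeaf_iff (he : Orthonormal ℂ e) :
    frameSum e v ∈ spiralLeaf σ e ε w ↔ v ∈ torusCoords σ e ∧ ∀ j, v j ∈ spiral ε (w j) :=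
  (frameSum_injective he).mem_set_image

theorem spiralLeaf_subset_torusFiber : spiralLeaf σ e ε w ⊆ torusFiber σ e :=
  image_mono fun _ hv => hv.1

theorem frameSum_mem_spiralLeaf_self (hw : w ∈ torusCoords σ e) :
    frameSum e w ∈ spiralLeaf σ e ε w :=
  ⟨w, ⟨hw, fun j => mem_spiral_self ε (w j)⟩, rfl⟩

theorem spiralLeaf_eq_of_mem (h : ∀ j, v j ∈ spiral ε (w j)) :
    spiralLeaf σ e ε v = spiralLeaf σ e ε w := by
  simp only [spiralLeaf, spiral_eq_of_mem (h _)]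

theorem exists_eq_spiralLeaf_of_mem {L : Set E} (hL : L ∈ spiralLeaves σ e ε) {x : E}
    (hx : x ∈ L) : ∃ w ∈ torusCoords σ e, x = frameSum e w ∧ L = spiralLeaf σ e ε w := by
  obtain ⟨v, -, rfl⟩ := hL
  obtain ⟨w, ⟨hw, hwv⟩, rfl⟩ := hx
  exact ⟨w, hw, rfl, (spiralLeaf_eq_of_mem hwv).symm⟩

theorem exists_logChart_torusFiber (he : Orthonormal ℂ e) (hc : c ∈ torusCoords σ e) :
    ∃ φ : OpenPartialHomeomorph E E, frameSum e c ∈ φ.source ∧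
      ContDiffOn ℂ ∞ φ φ.source ∧ ContDiffOn ℂ ∞ φ.symm φ.target ∧
      (∀ y ∈ φ.source, y ∈ torusFiber σ e ↔ φ y ∈ LinearMap.range (frameSum e).toLinearMap) ∧
      ∀ w, φ (frameSum e w) = frameSum e fun j => Complex.log (w j / c j) := by
  have hST := leftInverse_frameCoord_frameSum he
  set φ := extendAlong hST (logChart c hc.1)
  have hsource (w) : frameSum e w ∈ φ.source ↔ ∀ j, w j / c j ∈ Complex.slitPlane := by
    rw [← mem_logChart_source hc.1]
    change frameCoord e (frameSum e w) ∈ (logChart c hc.1).source ↔ _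
    rw [hST w]
  have hopen := isOpen_spaceFormDomain (E := E) σ
  refine ⟨φ.restrOpen _ hopen, ⟨(hsource c).2 fun j => ?_, hc.2⟩,
    (contDiffOn_extendAlong hST _ (contDiffOn_logChart hc.1)).mono inter_subset_left,
    (contDiffOn_extendAlong_symm hST _ (contDiff_logChart_symm hc.1).contDiffOn).mono
      inter_subset_left, fun y hy => ?_, fun w => extendAlong_apply hST _ w⟩
  · rw [div_self (hc.1 j)]
    exact Complex.one_mem_slitPlane
  · refine Iff.trans ⟨?_, ?_⟩ (extendAlong_mem_range_iff hST _).symm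
    · exact fun h => image_subset_range _ _ h
    · rintro ⟨w, rfl⟩
      refine ⟨w, ⟨fun j hj => Complex.slitPlane_ne_zero ((hsource w).1 hy.1 j) ?_, hy.2⟩, rfl⟩
      rw [hj, zero_div]

theorem isSubmanifold_torusFiber (he : Orthonormal ℂ e) :
    IsSubmanifold ℂ (Fintype.card ι) (torusFiber σ e) := by
  rintro _ ⟨c, hc, rfl⟩
  obtain ⟨φ, hcφ, hφ, hφsymm, hfiber, -⟩ := exists_logChart_torusFiber he hc
  exact ⟨φ, _, hcφ, hφ, hφsymm, finrank_range_frameSum he, hfiber⟩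

theorem isPathConnected_spiralLeaf (he : Orthonormal ℂ e) (hw : w ∈ torusCoords σ e) :
    IsPathConnected (spiralLeaf σ e ε w) := by
  let Ψ : (ι → ℝ) → ι → ℂ := fun s j => Complex.exp (s j * ε) * w j
  have hΨ : Continuous fun s => frameSum e (Ψ s) := by fun_prop
  have hleaf : spiralLeaf σ e ε w =
      (fun s => frameSum e (Ψ s)) '' {s | frameSum e (Ψ s) ∈ spaceFormDomain E σ} := by
    ext x
    constructor
    · rintro ⟨v, ⟨hv, hvw⟩, rfl⟩
      choose s hs using hvw
      obtain rfl : Ψ s = v := funext hs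
      exact ⟨s, hv.2, rfl⟩
    · rintro ⟨s, hs, rfl⟩
      exact ⟨Ψ s, ⟨⟨fun j => mul_ne_zero (Complex.exp_ne_zero _) (hw.1 j), hs⟩,
        fun j => ⟨s j, rfl⟩⟩, rfl⟩
  have hnorm : ∀ s, ‖frameSum e (Ψ s)‖ ^ 2 = ∑ j, ‖w j‖ ^ 2 * Real.exp (2 * ε.re * s j) := by
    intro s
    rw [norm_frameSum_sq he]
    refine Finset.sum_congr rfl fun j _ => ?_
    rw [norm_mul, Complex.norm_exp, Complex.re_ofReal_mul, mul_pow, ← Real.exp_nat_mul, mul_comm]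
    push_cast
    ring_nf
  have hconvex : ConvexOn ℝ univ fun s => ‖frameSum e (Ψ s)‖ ^ 2 := by
    simp only [hnorm]
    exact convexOn_sum convex_univ fun j =>
      (convexOn_exp.comp_linearMap ((2 * ε.re) • (LinearMap.proj j : (ι → ℝ) →ₗ[ℝ] ℝ))).smul
        (sq_nonneg ‖w j‖)
  rw [hleaf]
  refine IsPathConnected.image (Convex.isPathConnected ?_ ⟨0, ?_⟩) hΨ
  · exact convex_setOf_one_add_mul_pos hconvex (fun s => sq_nonneg _) σ
  · simpa [Ψ] using hw.2

theorem isFoliation_spiralLeaves (he : Orthonormal ℂ e) (hε : ε ≠ 0) :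
    IsFoliation (Fintype.card ι) (torusFiber σ e) (spiralLeaves σ e ε) where
  subset := forall_mem_image.2 fun w _ => spiralLeaf_subset_torusFiber
  existsUnique_leaf := by
    rintro _ ⟨w, hw, rfl⟩
    refine ⟨_, ⟨mem_image_of_mem _ hw, frameSum_mem_spiralLeaf_self hw⟩, ?_⟩
    rintro _ ⟨⟨v, -, rfl⟩, hwv⟩
    exact (spiralLeaf_eq_of_mem ((frameSum_mem_spiralLeaf_iff he).1 hwv).2).symm
  isPathConnected := forall_mem_image.2 fun w hw => isPathConnected_spiralLeaf he hw
  chart := by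
    rintro _ ⟨c, hc, rfl⟩
    obtain ⟨φ, hcφ, hφ, hφsymm, hfiber, hφlog⟩ := exists_logChart_torusFiber he hc
    refine ⟨φ, _, radialSpan e fun _ => ε, hcφ, hφ.restrict_scalars ℝ, hφsymm.restrict_scalars ℝ,
      radialSpan_le_range _, finrank_radialSpan he fun _ => hε, hfiber, forall_mem_image.2 ?_⟩
    refine fun w hw => ⟨range fun n : ι → ℤ => frameSum e fun j =>
      Complex.log (w j / c j) + n j * (2 * Real.pi * Complex.I), countable_range _, ?_⟩
    rintro _ - ⟨v, hv, rfl⟩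
    have hspiral (j) := (div_mem_spiral_div (hc.1 j)).symm.trans (mem_spiral_iff_exists_int hε
      (div_ne_zero (hv.1 j) (hc.1 j)) (div_ne_zero (hw.1 j) (hc.1 j)))
    simp only [frameSum_mem_spiralLeaf_iff he, hv, true_and, hspiral, Classical.skolem, hφlog,
      exists_range_iff, ← map_sub, frameSum_mem_radialSpan_iff he fun _ => hε, Pi.sub_apply]

end TorusFiber

/-! ### Tangent spaces of the leaves -/

theorem tangentVectors_subset_of_subset {F : Type*} [NormedAddCommGroup F] [NormedSpace ℝ F]
    {P : Submodule ℝ F} (hP : IsClosed (P : Set F)) {M : Set F} (hM : M ⊆ P) (x : F) :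
    tangentVectors M x ⊆ P := by
  rintro v ⟨γ, -, -, hγ', hγM⟩
  rw [← hγ'.deriv]
  exact deriv_mem_of_eventually_mem hP (hγM.mono fun t ht => hM ht)

section Tangent

variable {E : Type*} [NormedAddCommGroup E] [InnerProductSpace ℂ E] {ι : Type*} [Fintype ι]
  {e : ι → E} {σ : ℝ} {ε : ℂ} {w : ι → ℂ}

theorem torusFiber_subset_range (σ : ℝ) (e : ι → E) :
    torusFiber σ e ⊆ (LinearMap.range (frameSum e).toLinearMap).restrictScalars ℝ :=
  image_subset_range _ _

theorem isClosed_range_frameSum (he : Orthonormal ℂ e) :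
    IsClosed (((LinearMap.range (frameSum e).toLinearMap).restrictScalars ℝ : Submodule ℝ E) :
      Set E) :=
  isClosed_range_of_leftInverse (leftInverse_frameCoord_frameSum he)

theorem exists_hasDerivAt_frameCoord (he : Orthonormal ℂ e) {γ : ℝ → E} {t : ℝ}
    (hγ : DifferentiableAt ℝ γ t) (hmem : ∀ᶠ s in 𝓝 t, γ s ∈ range (frameSum e)) :
    ∃ b, deriv γ t = frameSum e b ∧ ∀ j, HasDerivAt (fun s => frameCoord e (γ s) j) (b j) t := by
  obtain ⟨b, hb⟩ := deriv_mem_of_eventually_mem (isClosed_range_frameSum he) hmem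
  refine ⟨b, hb.symm, hasDerivAt_pi.1 ?_⟩
  refine (((frameCoord e).restrictScalars ℝ).hasFDerivAt.comp_hasDerivAt t
    hγ.hasDerivAt).congr_deriv ?_
  rw [← hb]
  exact leftInverse_frameCoord_frameSum he b

theorem frameSum_mul_mem_tangentVectors {M : Set E} (lam : ι → ℂ)
    (hM : ∀ᶠ t : ℝ in 𝓝 0, (frameSum e fun j => Complex.exp (t * lam j) * w j) ∈ M) :
    frameSum e (lam * w) ∈ tangentVectors M (frameSum e w) := by
  have hcoord (j) : HasDerivAt (fun t : ℝ => Complex.exp (t * lam j) * w j) (lam j * w j) 0 := by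
    have hlin : HasDerivAt (fun t : ℝ => (t : ℂ) * lam j) (lam j) 0 := by
      simpa using (hasDerivAt_id (0 : ℝ)).ofReal_comp.mul_const (lam j)
    simpa using hlin.cexp.mul_const (w j)
  refine ⟨_, ?_, ?_, ((frameSum e).restrictScalars ℝ).hasFDerivAt.comp_hasDerivAt 0
    (hasDerivAt_pi.2 hcoord), hM⟩
  · refine ((frameSum e).restrictScalars ℝ).contDiff.comp (contDiff_pi.2 fun j => ?_)
    exact ((Complex.ofRealCLM.contDiff.mul contDiff_const).cexp).mul contDiff_const
  · simp

theorem eventually_exp_mul_mem_torusCoords (hw : w ∈ torusCoords σ e) (lam : ι → ℂ) :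
    ∀ᶠ t : ℝ in 𝓝 0, (fun j => Complex.exp (t * lam j) * w j) ∈ torusCoords σ e := by
  have hcont : ContinuousAt (fun (t : ℝ) j => Complex.exp (t * lam j) * w j) 0 := by fun_prop
  refine hcont.eventually_mem ((isOpen_torusCoords σ e).mem_nhds ?_)
  simpa using hw

theorem tangentVectors_torusFiber (he : Orthonormal ℂ e) (hw : w ∈ torusCoords σ e) :
    tangentVectors (torusFiber σ e) (frameSum e w) = range (frameSum e) := by
  refine Subset.antisymm (tangentVectors_subset_of_subset (isClosed_range_frameSum he)
    (torusFiber_subset_range σ e) _) ?_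
  rintro _ ⟨b, rfl⟩
  have hb : b / w * w = b := funext fun j => div_mul_cancel₀ _ (hw.1 j)
  rw [← hb]
  exact frameSum_mul_mem_tangentVectors _
    ((eventually_exp_mul_mem_torusCoords hw _).mono fun t ht => mem_image_of_mem _ ht)

theorem smul_apply_ne_zero (hε : ε ≠ 0) (hw : w ∈ torusCoords σ e) (j : ι) : (ε • w) j ≠ 0 :=
  mul_ne_zero hε (hw.1 j)

theorem tangentVectors_spiralLeaf (he : Orthonormal ℂ e) (hε : ε ≠ 0)
    (hw : w ∈ torusCoords σ e) :
    tangentVectors (spiralLeaf σ e ε w) (frameSum e w) = radialSpan e (ε • w) := by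
  apply Subset.antisymm
  · rintro _ ⟨γ, -, hγ₀, hγ', hγ⟩
    obtain ⟨b, hb, hu⟩ := exists_hasDerivAt_frameCoord he hγ'.differentiableAt
      (hγ.mono fun t ht => image_subset_range _ _ ht)
    have hST := leftInverse_frameCoord_frameSum he
    have hu₀ : frameCoord e (γ 0) = w := by rw [hγ₀, hST]
    rw [← hγ'.deriv, hb]
    refine (frameSum_mem_radialSpan_iff he (smul_apply_ne_zero hε hw)).2 fun j => ?_
    have hspiral : ∀ᶠ t in 𝓝 0, frameCoord e (γ t) j ∈ spiral ε (frameCoord e (γ 0) j) :=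
      hγ.mono fun t ⟨v, hv, hvγ⟩ => by
        rw [← hvγ, hST, hu₀]
        exact hv.2 j
    have hj := im_div_eq_zero_of_eventually_mem_spiral hε (hu j)
      (by simpa only [hu₀] using hw.1 j) hspiral
    rwa [hu₀] at hj
  · intro v hv
    obtain ⟨ρ, rfl⟩ := mem_radialSpan.1 hv
    have hρ : (fun j => ρ j * (ε • w) j) = (fun j => ρ j * ε) * w :=
      funext fun j => (mul_assoc _ _ _).symm
    rw [hρ]
    refine frameSum_mul_mem_tangentVectors _
      ((eventually_exp_mul_mem_torusCoords hw _).mono fun t ht => ⟨_, ⟨ht, fun j => ?_⟩, rfl⟩)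
    exact mem_spiral.2 ⟨t * ρ j, by rw [Complex.ofReal_mul, mul_assoc]⟩

end Tangent

/-! ### The Lagrangian frame -/

section LagrangianFrame

variable {E : Type*} [NormedAddCommGroup E] [InnerProductSpace ℂ E] {ι : Type*} [Fintype ι]
  {e : ι → E} {σ : ℝ} {ε : ℂ} {b w : ι → ℂ}

theorem spaceFormMetric_smul_smul_eq_zero_iff {x u v : E} (hε : ε ≠ 0) :
    spaceFormMetric σ x (ε • u) (ε • v) = 0 ↔ spaceFormMetric σ x u v = 0 := by
  rw [spaceFormMetric_smul_smul, mul_eq_zero, or_iff_right (by simpa using hε)]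

theorem frameSum_mem_radialSpan_iff_forall_spaceFormMetric (he : Orthonormal ℂ e)
    (hw : w ∈ torusCoords σ e) (v : ι → ℂ) :
    frameSum e v ∈ radialSpan e w ↔ ∀ u ∈ radialSpan e w,
      spaceFormMetric σ (frameSum e w) (frameSum e v) (Complex.I • u) = 0 :=
  (isTotallyReal_radialSpan he w).mem_iff_forall_spaceFormMetric_I_smul_eq_zero
    (frameSum_mem_radialSpan_self e w) hw.2 (exists_add_I_smul_eq_frameSum hw.1 v)

theorem isLagrangian_spiralLeaf (he : Orthonormal ℂ e) (hε : ε ≠ 0) {L : Set E}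
    (hL : L ∈ spiralLeaves σ e ε) : IsLagrangian (spaceFormMetric σ) (torusFiber σ e) L := by
  intro x hx v hv
  obtain ⟨w, hw, rfl, rfl⟩ := exists_eq_spiralLeaf_of_mem hL hx
  rw [tangentVectors_torusFiber he hw] at hv
  obtain ⟨b, rfl⟩ := hv
  obtain ⟨b, rfl⟩ : ∃ c, ε • c = b := ⟨ε⁻¹ • b, smul_inv_smul₀ hε b⟩
  simp only [tangentVectors_spiralLeaf he hε hw, SetLike.mem_coe, forall_mem_radialSpan_smul_iff hε,
    map_smul, smul_mem_radialSpan_smul_iff hε,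
    frameSum_mem_radialSpan_iff_forall_spaceFormMetric he hw, fundamentalForm,
    smul_comm Complex.I ε, spaceFormMetric_smul_smul_eq_zero_iff hε, spaceFormMetric_I_smul_left,
    neg_eq_zero]

theorem normalVectors_spiralLeaf_I (he : Orthonormal ℂ e) (hw : w ∈ torusCoords σ e) :
    normalVectors (spaceFormMetric σ) (torusFiber σ e) (spiralLeaf σ e Complex.I w)
      (frameSum e w) = radialSpan e w := by
  ext x
  simp only [normalVectors, tangentVectors_torusFiber he hw,
    tangentVectors_spiralLeaf he Complex.I_ne_zero hw, SetLike.mem_coe,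
    forall_mem_radialSpan_smul_iff Complex.I_ne_zero, mem_ofPred_eq]
  constructor
  · rintro ⟨⟨v, rfl⟩, hv⟩
    exact (frameSum_mem_radialSpan_iff_forall_spaceFormMetric he hw v).2 hv
  · intro hx
    obtain ⟨v, rfl⟩ := radialSpan_le_range w hx
    exact ⟨⟨v, rfl⟩, (frameSum_mem_radialSpan_iff_forall_spaceFormMetric he hw v).1 hx⟩

theorem tangentVectors_eq_normalVectors_of_mem_spiralLeaves (he : Orthonormal ℂ e) :
    ∀ L ∈ spiralLeaves σ e Complex.I, ∀ L' ∈ spiralLeaves σ e 1, ∀ x ∈ L ∩ L',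
      tangentVectors L' x = normalVectors (spaceFormMetric σ) (torusFiber σ e) L x := by
  rintro L hL L' hL' x ⟨hx, hx'⟩
  obtain ⟨w, hw, rfl, rfl⟩ := exists_eq_spiralLeaf_of_mem hL hx
  obtain ⟨w', -, hww', rfl⟩ := exists_eq_spiralLeaf_of_mem hL' hx'
  obtain rfl := frameSum_injective he hww'
  rw [tangentVectors_spiralLeaf he one_ne_zero hw, one_smul, normalVectors_spiralLeaf_I he hw]

theorem spiralLeaf_one_subset_radialSpan (σ : ℝ) (e : ι → E) (w : ι → ℂ) :
    spiralLeaf σ e 1 w ⊆ radialSpan e w := by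
  rintro _ ⟨v, ⟨-, hvw⟩, rfl⟩
  simp only [mem_spiral, mul_one] at hvw
  choose s hs using hvw
  refine mem_radialSpan.2 ⟨fun j => Real.exp (s j), congrArg _ (funext fun j => ?_)⟩
  rw [Complex.ofReal_exp, hs j]

theorem isTotallyGeodesic_spiralLeaf_one (he : Orthonormal ℂ e) {L : Set E}
    (hL : L ∈ spiralLeaves σ e 1) : IsTotallyGeodesic (spaceFormMetric σ) (torusFiber σ e) L := by
  have hLN : L ⊆ torusFiber σ e := (isFoliation_spiralLeaves he one_ne_zero).subset L hL
  refine fun a b γ ⟨hγ, hγL, hacc⟩ => ⟨hγ, fun t ht => hLN (hγL t ht), fun t ht y hy => ?_⟩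
  obtain ⟨w, hw, hγt, rfl⟩ := exists_eq_spiralLeaf_of_mem hL (hγL t ht)
  have hdomain : γ t ∈ spaceFormDomain E σ := hγt ▸ hw.2
  have hradial : ∀ᶠ s in 𝓝 t, γ s ∈ radialSpan e w :=
    mem_of_superset (Ioo_mem_nhds ht.1 ht.2) fun s hs =>
      spiralLeaf_one_subset_radialSpan σ e w (hγL s hs)
  rw [hγt, tangentVectors_torusFiber he hw] at hy
  obtain ⟨v, rfl⟩ := hy
  obtain ⟨p, hp, q, hq, hpq⟩ := exists_add_I_smul_eq_frameSum (e := e) hw.1 v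
  have hp' : p ∈ tangentVectors (spiralLeaf σ e 1 w) (γ t) := by
    rwa [hγt, tangentVectors_spiralLeaf he one_ne_zero hw, one_smul]
  rw [← hpq, covariantAcceleration_spaceFormMetric_add hdomain, hacc t ht p hp', zero_add]
  exact (isTotallyReal_radialSpan he w).covariantAcceleration_I_smul_eq_zero
    (isClosed_radialSpan e w) hradial hdomain hq

theorem eq_frameSum_of_isNormalPart (he : Orthonormal ℂ e) (hw : w ∈ torusCoords σ e) {x : E}
    (hx : IsNormalPart (spaceFormMetric σ) (spiralLeaf σ e Complex.I w) (frameSum e w)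
      (frameSum e b) x) :
    x = frameSum e fun j => (b j / w j).re * w j := by
  obtain ⟨hsub, horth⟩ := hx
  rw [tangentVectors_spiralLeaf he Complex.I_ne_zero hw] at hsub
  obtain ⟨c, hc⟩ := radialSpan_le_range _ hsub
  obtain rfl : frameSum e (b - c) = x := by
    rw [map_sub, sub_eq_iff_eq_add, ← sub_eq_iff_eq_add']
    exact hc.symm
  have hmem : frameSum e (b - c) ∈ radialSpan e w := by
    rw [← SetLike.mem_coe, ← normalVectors_spiralLeaf_I he hw, normalVectors,
      tangentVectors_torusFiber he hw]
    exact ⟨⟨_, rfl⟩, horth⟩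
  rw [← map_sub, sub_sub_cancel, SetLike.mem_coe,
    frameSum_mem_radialSpan_iff he (smul_apply_ne_zero Complex.I_ne_zero hw)] at hsub
  rw [frameSum_mem_radialSpan_iff he hw.1] at hmem
  refine congrArg _ (funext fun j => ?_)
  have hsub_re : (c j / w j).re = 0 := by
    have hj := hsub j
    rwa [Pi.smul_apply, smul_eq_mul, mul_comm, ← div_div, Complex.div_I, Complex.neg_im,
      Complex.mul_I_im, neg_eq_zero] at hj
  rw [← div_eq_iff (hw.1 j), ← Complex.conj_eq_iff_re.1 (Complex.conj_eq_iff_im.2 (hmem j)),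
    Pi.sub_apply, sub_div, Complex.sub_re, hsub_re, sub_zero]

theorem spaceFormMetric_frameSum_mul (he : Orthonormal ℂ e) {v : ι → ℂ}
    (hvw : ∀ j, ‖v j‖ = ‖w j‖) (ρ : ι → ℝ) :
    spaceFormMetric σ (frameSum e v) (frameSum e fun j => ρ j * v j) (frameSum e fun j => ρ j * v j)
    = spaceFormMetric σ (frameSum e w) (frameSum e fun j => ρ j * w j)
      (frameSum e fun j => ρ j * w j) := by
  have hinner (τ τ' : ι → ℝ) : ⟪frameSum e fun j => τ j * v j, frameSum e fun j => τ' j * v j⟫_ℂ =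
      ⟪frameSum e fun j => τ j * w j, frameSum e fun j => τ' j * w j⟫_ℂ := by
    simp only [inner_frameSum he, map_mul, mul_mul_mul_comm, Complex.conj_mul', hvw]
  have hone (u : ι → ℂ) : frameSum e u = frameSum e fun j => ((1 : ι → ℝ) j : ℂ) * u j := by simp
  simp only [spaceFormMetric, spaceFormHermitian, spaceFormDenom, hone v, hone w, hinner]

theorem norm_frameCoord_eq_of_mem_spiralLeaf_I (he : Orthonormal ℂ e) {L : Set E}
    (hL : L ∈ spiralLeaves σ e Complex.I) {x y : E} (hx : x ∈ L) (hy : y ∈ L) (j : ι) :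
    ‖frameCoord e x j‖ = ‖frameCoord e y j‖ := by
  obtain ⟨w, hw, rfl, rfl⟩ := exists_eq_spiralLeaf_of_mem hL hx
  obtain ⟨v, ⟨-, hvw⟩, rfl⟩ := hy
  rw [leftInverse_frameCoord_frameSum he, leftInverse_frameCoord_frameSum he,
    (mem_spiral_I_iff (hw.1 j)).1 (hvw j)]

theorem isRiemannianFoliation_spiralLeaves_I (he : Orthonormal ℂ e) :
    IsRiemannianFoliation (spaceFormMetric σ) (spiralLeaves σ e Complex.I) := by
  rintro Γ ⟨hΓ, hleaf⟩ L hL hΓL x y hx hy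
  have hfoliation := isFoliation_spiralLeaves (σ := σ) he Complex.I_ne_zero
  have hzero : (0 : ℝ) ∈ Icc (0 : ℝ) 1 := left_mem_Icc.2 zero_le_one
  have hone : (1 : ℝ) ∈ Icc (0 : ℝ) 1 := right_mem_Icc.2 zero_le_one
  have hΓL' : Γ 1 0 ∈ L := by
    obtain ⟨L', hL', hΓL'⟩ := hleaf.self_of_nhds
    rw [(hfoliation.existsUnique_leaf _ (hfoliation.subset L hL hΓL)).unique ⟨hL, hΓL⟩
      ⟨hL', hΓL' 0 hzero⟩]
    exact hΓL' 1 hone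
  have hcoord (t : ℝ) (ht : t ∈ Icc (0 : ℝ) 1) : ∃ b, deriv (fun s => Γ t s) 0 = frameSum e b ∧
      ∀ j, HasDerivAt (fun s => frameCoord e (Γ t s) j) (b j) 0 := by
    refine exists_hasDerivAt_frameCoord he ?_ (hleaf.mono fun s ⟨L', hL', hs⟩ =>
      image_subset_range _ _ (hfoliation.subset L' hL' (hs t ht)))
    exact ((hΓ.comp (contDiff_prodMk_right t)).differentiable (by simp)) 0
  have hnorm (j : ι) : ∀ᶠ s in 𝓝 0, ‖frameCoord e (Γ 0 s) j‖ = ‖frameCoord e (Γ 1 s) j‖ :=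
    hleaf.mono fun s ⟨L', hL', hs⟩ =>
      norm_frameCoord_eq_of_mem_spiralLeaf_I he hL' (hs 0 hzero) (hs 1 hone) j
  obtain ⟨b, hb, hb'⟩ := hcoord 0 hzero
  obtain ⟨c, hc, hc'⟩ := hcoord 1 hone
  have hre (j) := re_div_eq_of_eventually_norm_eq (hb' j) (hc' j) (hnorm j)
  obtain ⟨v, hv, hv₀, hvL⟩ := exists_eq_spiralLeaf_of_mem hL hΓL
  obtain ⟨w, hw, hw₀, hwL⟩ := exists_eq_spiralLeaf_of_mem hL hΓL'
  have hvw (j) := (hnorm j).self_of_nhds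
  simp only [hv₀, hw₀, leftInverse_frameCoord_frameSum he _] at hre hvw
  rw [hb, hv₀, hvL] at hx
  rw [hc, hw₀, hwL] at hy
  rw [eq_frameSum_of_isNormalPart he hv hx, eq_frameSum_of_isNormalPart he hw hy, hv₀, hw₀]
  simp only [hre]
  exact spaceFormMetric_frameSum_mul he hvw _

theorem isLagrangianFrame_spiralLeaves (he : Orthonormal ℂ e) :
    IsLagrangianFrame (spaceFormMetric σ) (Fintype.card ι) (torusFiber σ e)
      (spiralLeaves σ e Complex.I) (spiralLeaves σ e 1) where
  foliation_fst := isFoliation_spiralLeaves he Complex.I_ne_zero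
  foliation_snd := isFoliation_spiralLeaves he one_ne_zero
  lagrangian_fst _ := isLagrangian_spiralLeaf he Complex.I_ne_zero
  lagrangian_snd _ := isLagrangian_spiralLeaf he one_ne_zero
  orthogonal L hL L' hL' x hx v hv v' hv' := by
    rw [tangentVectors_eq_normalVectors_of_mem_spiralLeaves he L hL L' hL' x hx] at hv'
    rw [spaceFormMetric_symm]
    exact hv'.2 v hv
  riemannian := isRiemannianFoliation_spiralLeaves_I he
  totallyGeodesic _ := isTotallyGeodesic_spiralLeaf_one he

end LagrangianFrame

/-! ### The fibers of `π_k` -/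

section UnitRep

variable {𝕜 V : Type*} [RCLike 𝕜] [NormedAddCommGroup V] [NormedSpace 𝕜 V]

/-- A vector of norm one on the line `p`. -/
noncomputable def unitRep (p : ℙ 𝕜 V) : V := (‖p.rep‖ : 𝕜)⁻¹ • p.rep

theorem norm_unitRep (p : ℙ 𝕜 V) : ‖unitRep p‖ = 1 := norm_smul_inv_norm p.rep_nonzero

theorem unitRep_ne_zero (p : ℙ 𝕜 V) : unitRep p ≠ 0 :=
  norm_ne_zero_iff.1 ((norm_unitRep p).trans_ne one_ne_zero)

theorem mk_unitRep (p : ℙ 𝕜 V) : Projectivization.mk 𝕜 (unitRep p) (unitRep_ne_zero p) = p := by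
  conv_rhs => rw [← p.mk_rep]
  exact (Projectivization.mk_eq_mk_iff' ..).2 ⟨_, rfl⟩

theorem mk_eq_iff_exists_smul_unitRep {p : ℙ 𝕜 V} {v : V} (hv : v ≠ 0) :
    Projectivization.mk 𝕜 v hv = p ↔ ∃ c : 𝕜, c • unitRep p = v := by
  rw [← Projectivization.mk_eq_mk_iff' 𝕜 v _ hv (unitRep_ne_zero p), mk_unitRep]

end UnitRep

section Blocks

variable {l : ℕ} {k : Fin l → ℕ}

theorem inner_eq_sum_inner_block (z w : Cn k) :
    ⟪z, w⟫_ℂ = ∑ j, ⟪block z j, block w j⟫_ℂ := by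
  simp only [PiLp.inner_apply, block, Fintype.sum_sigma]

theorem eq_iff_forall_block_eq {z w : Cn k} : z = w ↔ ∀ j, block z j = block w j := by
  refine ⟨fun h j => h ▸ rfl, fun h => ?_⟩
  ext ⟨j, i⟩
  exact congrArg (· i) (h j)

/-- The vectors of `ℂⁿ` whose `j`-th one has `j`-th block `e j` and all other blocks zero. -/
noncomputable def blockFrame (e : ∀ j, EuclideanSpace ℂ (Fin (k j))) (j : Fin l) : Cn k :=
  WithLp.toLp 2 fun a => if a.1 = j then e a.1 a.2 else 0

variable {e : ∀ j, EuclideanSpace ℂ (Fin (k j))} {w : Fin l → ℂ} {X : Geom}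

theorem block_blockFrame (i j : Fin l) : block (blockFrame e i) j = if j = i then e j else 0 := by
  ext a
  by_cases h : j = i <;> simp [block, blockFrame, h]

theorem block_frameSum_blockFrame (e : ∀ j, EuclideanSpace ℂ (Fin (k j))) (w : Fin l → ℂ)
    (j : Fin l) : block (frameSum (blockFrame e) w) j = w j • e j := by
  ext i
  simp [block, blockFrame, frameSum_apply]

theorem orthonormal_blockFrame (he : ∀ j, ‖e j‖ = 1) : Orthonormal ℂ (blockFrame e) := by
  rw [orthonormal_iff_ite]
  intro i j
  rw [inner_eq_sum_inner_block, Finset.sum_eq_single i]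
  · rw [block_blockFrame, block_blockFrame, if_pos rfl]
    split_ifs with hij
    · rw [inner_self_eq_norm_sq_to_K, he, RCLike.ofReal_one, one_pow]
    · rw [inner_zero_right]
  · intro m _ hm
    rw [block_blockFrame, if_neg hm, inner_zero_left]
  · exact fun h => absurd (Finset.mem_univ i) h

/-- The sign `σ` for which the geometry is that of `spaceFormMetric σ`. -/
def curvatureSign : Geom → ℝ
  | .projective => 1
  | .hyperbolic => -1

theorem domain_eq_spaceFormDomain (k : Fin l → ℕ) (X : Geom) :
    domain k X = spaceFormDomain (Cn k) (curvatureSign X) := by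
  ext z
  cases X
  · simp only [domain, spaceFormDomain, curvatureSign, mem_univ, mem_ofPred_eq, true_iff]
    positivity
  · rw [domain, mem_ball_zero_iff, ← sq_lt_one_iff₀ (norm_nonneg z)]
    simp only [spaceFormDomain, curvatureSign, mem_ofPred_eq]
    constructor <;> intro h <;> linarith

theorem kahlerMetric_eq_spaceFormMetric (k : Fin l → ℕ) (X : Geom) :
    kahlerMetric (k := k) X = spaceFormMetric (curvatureSign X) := by
  have hdiv (d a b : ℂ) : (d * a - b) / d ^ 2 = a / d - b / d ^ 2 := by
    rw [sub_div, sq, ← div_div, mul_div_right_comm]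
    rcases eq_or_ne d 0 with rfl | hd
    · simp
    · rw [div_self hd, one_mul]
  ext z u v
  cases X <;>
    simp [kahlerMetric, hermitianForm, spaceFormMetric, spaceFormHermitian,
      spaceFormDenom_eq_ofReal, curvatureSign, ← hdiv, sub_eq_add_neg]

theorem fiber_eq_torusFiber (X : Geom) (p : ∀ j, ℙ ℂ (EuclideanSpace ℂ (Fin (k j)))) :
    fiber X p = torusFiber (curvatureSign X) (blockFrame fun j => unitRep (p j)) := by
  ext z
  rw [fiber, domain_eq_spaceFormDomain]
  constructor
  · rintro ⟨hz, hzk, hzp⟩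
    choose w hw using fun j => (mk_eq_iff_exists_smul_unitRep (hzk j)).1 (congrFun hzp j)
    obtain rfl := eq_iff_forall_block_eq.2 fun j =>
      (block_frameSum_blockFrame _ w j).trans (hw j)
    exact ⟨w, ⟨fun j hj => hzk j (by rw [← hw j, hj, zero_smul]), hz⟩, rfl⟩
  · rintro ⟨w, ⟨hw, hz⟩, rfl⟩
    have hblock := block_frameSum_blockFrame (fun j => unitRep (p j)) w
    exact ⟨hz, fun j => hblock j ▸ smul_ne_zero (hw j) (unitRep_ne_zero _), funext fun j =>
      (mk_eq_iff_exists_smul_unitRep _).2 ⟨w j, (hblock j).symm⟩⟩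

theorem mem_orbitTk_iff {z w : Cn k} :
    w ∈ orbitTk z ↔ ∃ s : Fin l → Circle, ∀ j, block w j = (s j : ℂ) • block z j := by
  constructor
  · rintro ⟨t, ⟨s, hs⟩, rfl⟩
    refine ⟨s, fun j => ?_⟩
    ext i
    simp [block, torusAct, hs]
  · rintro ⟨s, hs⟩
    exact ⟨fun a => s a.1, ⟨s, fun _ => rfl⟩, eq_iff_forall_block_eq.2 hs⟩

theorem orbitTk_frameSum_blockFrame {σ : ℝ} (he : ∀ j, ‖e j‖ = 1)
    (hw : w ∈ torusCoords σ (blockFrame e)) :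
    orbitTk (frameSum (blockFrame e) w) = spiralLeaf σ (blockFrame e) Complex.I w := by
  ext z
  simp only [mem_orbitTk_iff, block_frameSum_blockFrame, smul_smul]
  constructor
  · rintro ⟨s, hs⟩
    obtain rfl := eq_iff_forall_block_eq.2 fun j =>
      (block_frameSum_blockFrame e (fun j => s j * w j) j).trans (hs j).symm
    have hnorm (j) : ‖(s j : ℂ) * w j‖ = ‖w j‖ := by rw [norm_mul, Circle.norm_coe, one_mul]
    exact ⟨_, ⟨⟨fun j => mul_ne_zero (s j).coe_ne_zero (hw.1 j),
      (mem_spaceFormDomain_iff_of_norm_eq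
        (norm_frameSum_eq (orthonormal_blockFrame he) hnorm)).2 hw.2⟩,
      fun j => (mem_spiral_I_iff (hw.1 j)).2 (hnorm j)⟩, rfl⟩
  · rintro ⟨v, ⟨-, hv⟩, rfl⟩
    choose s hs using fun j => mem_spiral.1 (hv j)
    exact ⟨fun j => Circle.exp (s j), fun j => by
      rw [block_frameSum_blockFrame, Circle.coe_exp, hs]⟩

theorem orbitLeaves_eq_spiralLeaves (X : Geom) (p : ∀ j, ℙ ℂ (EuclideanSpace ℂ (Fin (k j)))) :
    orbitLeaves X p =
      spiralLeaves (curvatureSign X) (blockFrame fun j => unitRep (p j)) Complex.I := by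
  rw [orbitLeaves, fiber_eq_torusFiber, torusFiber, image_image, spiralLeaves]
  exact image_congr fun w hw => orbitTk_frameSum_blockFrame (fun j => norm_unitRep (p j)) hw

theorem prod_pow_mul_prod_conj_pow_eq_one {p q : (Σ j : Fin l, Fin (k j)) → ℕ}
    (hpq : ∀ j, ∑ i, p ⟨j, i⟩ = ∑ i, q ⟨j, i⟩) (s : Fin l → Circle) :
    (∏ b, (s b.1 : ℂ) ^ p b) * ∏ b, starRingEnd ℂ (s b.1) ^ q b = 1 := by
  rw [Fintype.prod_sigma, Fintype.prod_sigma, ← Finset.prod_mul_distrib]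
  refine Finset.prod_eq_one fun j _ => ?_
  dsimp only
  rw [Finset.prod_pow_eq_pow_sum, Finset.prod_pow_eq_pow_sum, hpq, ← mul_pow, Complex.mul_conj',
    Circle.norm_coe, Complex.ofReal_one, one_pow, one_pow]

theorem symbol_eq_of_mem_orbitTk {h : Fin l → ℕ} {f : ↥(Vk k ∩ domain k X) → ℂ}
    (hf : f ∈ symbols X k h) {x : Cn k} {z w : ↥(Vk k ∩ domain k X)} (hz : z.1 ∈ orbitTk x)
    (hw : w.1 ∈ orbitTk x) : f z = f w := by
  obtain ⟨a, p, q, -, hpq, -, -, hf⟩ := hf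
  have hconst (y : Cn k) (hy : y ∈ orbitTk x) : a (fun j => ‖block y j‖) *
      ((∏ b, (y b / ‖block y b.1‖) ^ p b) * ∏ b, starRingEnd ℂ (y b / ‖block y b.1‖) ^ q b) =
      a (fun j => ‖block x j‖) * ((∏ b, (x b / ‖block x b.1‖) ^ p b) *
        ∏ b, starRingEnd ℂ (x b / ‖block x b.1‖) ^ q b) := by
    obtain ⟨s, hs⟩ := mem_orbitTk_iff.1 hy
    have hnorm (j) : ‖block y j‖ = ‖block x j‖ := by
      rw [hs, norm_smul, Circle.norm_coe, one_mul]
    have hcoord (b) : y b = s b.1 * x b := congrArg (· b.2) (hs b.1)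
    simp only [hnorm, hcoord, mul_div_assoc, map_mul, mul_pow, Finset.prod_mul_distrib]
    rw [mul_mul_mul_comm, prod_pow_mul_prod_conj_pow_eq_one hpq, one_mul]
  rw [hf, hf, hconst _ hz, hconst _ hw]

end Blocks

theorem mainTheorem7 {l : ℕ} (k : Fin l → ℕ) (hk : ∀ j, 0 < k j) (h : Fin l → ℕ) (X : Geom)
    (p : ∀ j, ℙ ℂ (EuclideanSpace ℂ (Fin (k j)))) :
    IsKahlerSubmanifold (kahlerMetric X) (domain k X) l (fiber X p) ∧
    (IsFoliation l (fiber X p) (orbitLeaves X p) ∧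
      IsRiemannianFoliation (kahlerMetric X) (orbitLeaves X p) ∧
      ∀ f ∈ symbols X k h, ∀ L ∈ orbitLeaves X p, ∀ z w : ↥(Vk k ∩ domain k X),
        z.1 ∈ L → w.1 ∈ L → f z = f w) ∧
    ∃ 𝓕 : Set (Set (Cn k)),
      (IsFoliation l (fiber X p) 𝓕 ∧
        (∀ L ∈ orbitLeaves X p, ∀ L' ∈ 𝓕, ∀ x ∈ L ∩ L',
          tangentVectors L' x = normalVectors (kahlerMetric X) (fiber X p) L x) ∧
        ∀ L' ∈ 𝓕, IsTotallyGeodesic (kahlerMetric X) (fiber X p) L') ∧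
      IsLagrangianFrame (kahlerMetric X) l (fiber X p) (orbitLeaves X p) 𝓕 := by
  have hsymbol : ∀ f ∈ symbols X k h, ∀ L ∈ orbitLeaves X p, ∀ z w : ↥(Vk k ∩ domain k X),
      z.1 ∈ L → w.1 ∈ L → f z = f w := by
    rintro f hf _ ⟨x, -, rfl⟩ z w hz hw
    exact symbol_eq_of_mem_orbitTk hf hz hw
  have he : Orthonormal ℂ (blockFrame fun j => unitRep (p j)) :=
    orthonormal_blockFrame fun j => norm_unitRep (p j)
  have hkahler := isKahlerMetric_spaceFormMetric (E := Cn k) (curvatureSign X)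
  have hsubmanifold := isSubmanifold_torusFiber (σ := curvatureSign X) he
  have hframe := isLagrangianFrame_spiralLeaves (σ := curvatureSign X) he
  have hnormal := tangentVectors_eq_normalVectors_of_mem_spiralLeaves (σ := curvatureSign X) he
  simp only [← domain_eq_spaceFormDomain, ← kahlerMetric_eq_spaceFormMetric,
    ← fiber_eq_torusFiber, ← orbitLeaves_eq_spiralLeaves, Fintype.card_fin]
    at hkahler hsubmanifold hframe hnormal
  exact ⟨⟨hkahler, fun z hz => hz.1, hsubmanifold⟩,
    ⟨hframe.foliation_fst, hframe.riemannian, hsymbol⟩, _,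
    ⟨hframe.foliation_snd, hnormal, hframe.totallyGeodesic⟩, hframe⟩
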